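/- **Setting.** Let $k:\mathcal X\times\mathcal X\to\mathbb R$ be a positive (semidefinite), infinitely divisible kernel (that is, $k\ge 0$ and $k^r$ is a positive semidefinite kernel for every real $r>0$), let $n\ge 2$ and $x_1,\dots,x_n\in\mathcal X$. The normalized kernel matrix is $A_{ij}=\frac1n\,\frac{K_{ij}}{\sqrt{K_{ii}K_{jj}}}$ with $K_{ij}=k(x_i,x_j)$. For $\alpha>0$, $\alpha\ne1$, its matrix-based Rényi entropy is $S_\alpha(A)=\frac1{1-\alpha}\log\sum_i\lambda_i(A)^\alpha$. Suppose that all eigenvalues of $A$ lie in $[u,v]$ with $u>0$. **Algorithm** (input $A,s,\alpha,m,u,v$, with $4\mid s$). 1. Replace $v$ by $\max\bigl(v,\,u+2\sqrt{2u-u^2}\bigr)$. Below, $v$ denotes this new value, and $\kappa=v/u$. 2. Let $g:[-1,1]\to[u,v]$ be the increasing affine bijection, $t_i=\cos\frac{\pi(i+1/2)}{m+1}$, $c_j=\frac2{m+1}\sum_{i=0}^m g(t_i)^\alpha\,T_j(t_i)$ with $T_j$ the Chebyshev polynomials, and $F=\frac{c_0}2 I+\sum_{j=1}^m c_j\,(T_j\circ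 g^{-1})(A)$. 3. (Hutch++ for $F$.) Draw $S\in\mathbb R^{n\times s/4}$ and $G\in\mathbb R^{n\times s/2}$ with i.i.d. standard Gaussian entries. Let the columns of $Q$ be an orthonormal basis of the column space of $BS$, where $B=F$, and put $$Z=\operatorname{tr}(Q^\top FQ)+\tfrac2s\operatorname{tr}\bigl(G^\top(I-QQ^\top)F(I-QQ^\top)G\bigr).$$ 4. Return $\tilde S_\alpha(A)=\frac1{1-\alpha}\log Z$. **Theorem.** For every $\delta_0<1$ there is a constant $C_s>0$ depending only on $\delta_0$, and for every $\bar\alpha$ there is a constant $C_m>0$ depending only on $\bar\alpha$ and $\delta_0$, such that the following holds for all $\alpha\in(0,\bar\alpha]$ with $\alpha\ne1$, all $\varepsilon\in(0,1)$, all $\delta\in(0,\delta_0]$, and all $\mathcal X,k,n,x_1,\dots,x_n,u,v$ as above. If $s$ (a multiple of $4$) and $m$ satisfy $$s\ \ge\ C_s\Bigl(\frac1{\varepsilon|\alpha-1|}\sqrt{\log\tfrac1\delta}+\log\tfrac1\delta\Bigr),\qquad m\ \ge\ C_m\sqrt\kappa\,\log\frac{\kappa}{\min\{1,\varepsilon|\alpha-1|\}},$$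 then, with probability at least $1-\delta$, $$|\tilde S_\alpha(A)-S_\alpha(A)|\le\varepsilon\,S_\alpha(A).$$ If $\alpha\le2$, the same conclusion (with the same constants) also holds for the variant of the algorithm in which $Q$ is an orthonormal basis of the column space of $AS$, i.e. $B=A$ in step 3. -/

import Mathlib

open MeasureTheory ProbabilityTheory

noncomputable section

/-- A real-valued positive (semidefinite) kernel: all of its Gram matrices are symmetric
positive semidefinite. -/
def IsPositiveKernel {X : Type*} (k : X → X → ℝ) : Prop :=
  ∀ (n : ℕ) (x : Fin n → X), (Matrix.of fun i j => k (x i) (x j)).PosSemidef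

/-- An infinitely divisible positive kernel: it is entrywise nonnegative and every entrywise
power with a positive real exponent is a positive kernel (exponent `1` is the kernel itself). -/
def IsInfinitelyDivisibleKernel {X : Type*} (k : X → X → ℝ) : Prop :=
  (∀ x y, 0 ≤ k x y) ∧ ∀ r : ℝ, 0 < r → IsPositiveKernel fun x y => k x y ^ r

/-- The normalized kernel matrix `A i j = (1 / n) * K i j / √(K i i * K j j)` of a sample
`x`, where `K i j = k (x i) (x j)` is the Gram matrix. -/
def normalizedKernelMatrix {X : Type*} {n : ℕ} (k : X → X → ℝ) (x : Fin n → X) :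
    Matrix (Fin n) (Fin n) ℝ :=
  Matrix.of fun i j => 1 / (n : ℝ) * (k (x i) (x j) / √(k (x i) (x i) * k (x j) (x j)))

theorem normalizedKernelMatrix_isHermitian {X : Type*} {n : ℕ} {k : X → X → ℝ}
    (hk : IsInfinitelyDivisibleKernel k) (x : Fin n → X) :
    (normalizedKernelMatrix k x).IsHermitian := by
  have h : (Matrix.of fun i j => k (x i) (x j)).IsHermitian := by
    simpa using (hk.2 1 one_pos n x).1
  ext i j
  have hij : k (x j) (x i) = k (x i) (x j) := by simpa using h.apply i j
  simp [normalizedKernelMatrix, hij, mul_comm]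

/-- The matrix-based Rényi entropy `S_α(A) = (1 / (1 - α)) * log (∑ i, λ_i(A) ^ α)`. -/
def renyiEntropy {n : ℕ} (α : ℝ) {A : Matrix (Fin n) (Fin n) ℝ} (hA : A.IsHermitian) : ℝ :=
  1 / (1 - α) * Real.log (∑ i, hA.eigenvalues i ^ α)

/-- The column space of a matrix, as a subspace of Euclidean space. -/
def columnSpace {n k : ℕ} (M : Matrix (Fin n) (Fin k) ℝ) :
    Submodule ℝ (EuclideanSpace ℝ (Fin n)) :=
  Submodule.span ℝ (Set.range fun j => WithLp.toLp 2 fun i => M i j)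

/-- A matrix whose columns are an orthonormal basis of the column space of `M`. -/
def orthonormalBasisMatrix {n k : ℕ} (M : Matrix (Fin n) (Fin k) ℝ) :
    Matrix (Fin n) (Fin (Module.finrank ℝ (columnSpace M))) ℝ :=
  Matrix.of fun i j =>
    (stdOrthonormalBasis ℝ (columnSpace M) j : EuclideanSpace ℝ (Fin n)) i

/-- The Hutch++ estimate of the trace of `F`, for sample matrices `S` and `G`, where the
orthonormal basis `Q` is computed for the span of `B * S`. Hutch++ for the matrix `F` has
`B = F`. The value depends on `Q` only through `Q * Qᵀ`, the orthogonal projection onto that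
span, so it does not depend on the choice of the basis. -/
def hutchpp {n : ℕ} (B F : Matrix (Fin n) (Fin n) ℝ) (s : ℕ)
    (S : Matrix (Fin n) (Fin (s / 4)) ℝ) (G : Matrix (Fin n) (Fin (s / 2)) ℝ) : ℝ :=
  let Q := orthonormalBasisMatrix (B * S)
  (Q.transpose * F * Q).trace +
    2 / (s : ℝ) *
      (G.transpose * (1 - Q * Q.transpose) * F * (1 - Q * Q.transpose) * G).trace

/-- The law of the array of entries of an `n × k` matrix with i.i.d. standard Gaussian entries. -/
def gaussianMatrix (n k : ℕ) : Measure (Fin n → Fin k → ℝ) :=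
  Measure.pi fun _ : Fin n => Measure.pi fun _ : Fin k => gaussianReal 0 1

/-- The node `x_i = cos (π (i + 1/2) / (m + 1))`. -/
def chebyshevNode (m i : ℕ) : ℝ := Real.cos (Real.pi * (i + 1 / 2) / (m + 1))

/-- The coefficient `c_j = (2 / (m + 1)) * ∑ i ≤ m, f (x_i) * T_j (x_i)` of a function `f` on
`[-1, 1]`. -/
def chebyshevCoeff (f : ℝ → ℝ) (m j : ℕ) : ℝ :=
  2 / ((m : ℝ) + 1) * ∑ i ∈ Finset.range (m + 1),
    f (chebyshevNode m i) * (Polynomial.Chebyshev.T ℝ (j : ℤ)).eval (chebyshevNode m i)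

/-- The linear map `g` from `[-1, 1]` onto `[u, v]`. -/
def fromUnitInterval (u v x : ℝ) : ℝ := (u + v) / 2 + (v - u) / 2 * x

/-- The inverse `g⁻¹` of the linear map from `[-1, 1]` onto `[u, v]`, as a polynomial. -/
def toUnitInterval (u v : ℝ) : Polynomial ℝ :=
  Polynomial.C (2 / (v - u)) * Polynomial.X - Polynomial.C ((u + v) / (v - u))

/-- The Chebyshev approximant `c_0 / 2 + ∑ 1 ≤ j ≤ m, c_j * T_j ∘ g⁻¹` of degree `m` of a
function `f` on `[u, v]`, where the `c_j` are the coefficients of `f ∘ g`. -/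
def chebyshevApprox (f : ℝ → ℝ) (u v : ℝ) (m : ℕ) : Polynomial ℝ :=
  Polynomial.C (chebyshevCoeff (fun x => f (fromUnitInterval u v x)) m 0 / 2) +
    ∑ j ∈ Finset.Icc 1 m,
      Polynomial.C (chebyshevCoeff (fun x => f (fromUnitInterval u v x)) m j) *
        (Polynomial.Chebyshev.T ℝ (j : ℤ)).comp (toUnitInterval u v)

/-- The upper end `max (v, u + 2 √(2u - u²))` that the algorithm assigns to `v`. -/
def widenedUpper (u v : ℝ) : ℝ := max v (u + 2 * √(2 * u - u ^ 2))

/-- The matrix polynomial whose trace the algorithm estimates: the degree `m` Chebyshev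
approximant of `t ^ α` on `[u, v]`, with `v` replaced by its widened value, evaluated at `A`. -/
def chebyshevPower {n : ℕ} (A : Matrix (Fin n) (Fin n) ℝ) (α : ℝ) (m : ℕ) (u v : ℝ) :
    Matrix (Fin n) (Fin n) ℝ :=
  Polynomial.aeval A (chebyshevApprox (fun t => t ^ α) u (widenedUpper u v) m)

/-- The output `(1 / (1 - α)) * log (Hutch++)` of the algorithm for kernel matrix `A`, number
of random vectors `s`, order `α`, polynomial degree `m` and eigenvalue bounds `u`, `v`, on the
samples `S`, `G`; the matrix `B` is the one that the range finder of Hutch++ multiplies. -/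
def chebyshevRenyi {n : ℕ} (B A : Matrix (Fin n) (Fin n) ℝ) (s : ℕ) (α : ℝ) (m : ℕ) (u v : ℝ)
    (S : Matrix (Fin n) (Fin (s / 4)) ℝ) (G : Matrix (Fin n) (Fin (s / 2)) ℝ) : ℝ :=
  1 / (1 - α) * Real.log (hutchpp B (chebyshevPower A α m u v) s S G)

end

/-!
Write `w_i` for the eigenvalues of the normalized kernel matrix `A`. They are positive and sum to
one (`sum_eigenvalues_normalizedKernelMatrix`). Let `w_(i₀)` be the largest one, and let `T = ∑_(i
≠ i₀) w_i ^ α` be the *tail*. A concentrated spectrum makes the entropy small, but the tail is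
then just as small: `|log ∑ w_i ^ α|` is at least of order `|α - 1| T / ∑ w_i ^ α`
(`tail_div_le_abs_log_sum_rpow`). It is therefore enough to estimate `∑ w_i ^ α` up to a small
multiple of `min 1 (ε |α - 1|) T` (`abs_log_sub_log_sum_rpow_le`). This error has two sources.

*Interpolation.* Let `F` be the Chebyshev approximant of `A ^ α`. By induction along `2 X T_a =
T_(a+1) + T_(a-1)`, the interpolation error of `x ^ j` is at most `(2 m + 2) cosh θ ^ j / cosh (m
θ)` for every `θ`; this plays the part of a Bernstein ellipse, without complex analysis. Summing
the binomial series of `(1 + r x) ^ α` with `θ = 1 / √κ` bounds the error for `t ^ α` by `exp (-m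
/ √κ)` times a polynomial factor (`exists_abs_eval_chebyshevApprox_rpow_sub_le`). Widening the
interval gives `κ ≥ 4`, so that `log (κ / min 1 (ε |α - 1|))` is at least one. Each eigenvalue of
`F` is within a small multiple of `min 1 (ε |α - 1|) u ^ α` of `w_i ^ α`, and `(n - 1) u ^ α ≤ T`.

*Hutch++.* With `k = s / 4`, let `I` be a set of at most `k / 2` leading eigenvectors. If `y` is
orthogonal to the range of `B S`, its coordinates form a linear relation between the Gaussian
vectors `ω_i = u_iᵀ S ∈ ℝᵏ`. The vectors with index in `I` have smallest singular value of order
`√k` (`gaussianMatrix_le_norm_sum_sq`), and the remaining ones, weighted by the small eigenvalues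
of `B`, have norm at most of order `√k` (`gaussianMatrix_weighted_norm_le`). Hence the relation
bounds the coordinates of `y` in `I`, and the part of `F` that the range finder leaves over has
norm `O(T / k)` and trace `O(T)` (`IsSketchable.residual_bounds`). Both singular value bounds hold
outside events of probability `exp (-k)`; instead of a union bound over a net, a point at which
the bound fails is thickened to a ball of such points, and Fubini's theorem compares volumes
(`measure_le_of_exists_ball`). Hutchinson's estimator for the remaining part obeys a `χ²` Chernoff
bound with exponent of order `t² s²` for an error `t T` (`gaussianMatrix_hutchinson_le`); this is
the reason why `s` grows only like `√(log (1 / δ)) / (ε |α - 1|)`.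

For `B = A` the same argument applies with weights `w_i` in place of `f_i ≈ w_i ^ α`. The relation
then has to be compared with `F` through `w_i ^ α = w_i ^ (α - 2) w_i ^ 2`, and the monotonicity
of `t ^ (α - 2)` requires `α ≤ 2` (`exists_isSketchable`).
-/

/-! ### Gaussian vectors and matrices -/

/-- The law of a vector with i.i.d. standard Gaussian coordinates. -/
noncomputable abbrev gaussianVector (ι : Type*) [Fintype ι] : Measure (ι → ℝ) :=
  Measure.pi fun _ : ι => gaussianReal 0 1

instance isProbabilityMeasure_gaussianMatrix (n k : ℕ) :
    IsProbabilityMeasure (gaussianMatrix n k) := by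
  unfold gaussianMatrix; infer_instance

theorem gaussianMatrix_map_transpose (n k : ℕ) :
    (gaussianMatrix n k).map (fun S j i => S i j) = gaussianMatrix k n := by
  have curry (a b : ℕ) : gaussianMatrix a b = (gaussianVector (Fin a × Fin b)).map
      (MeasurableEquiv.curry (Fin a) (Fin b) ℝ) := by
    have h := Measure.infinitePi_map_curry (ι := Fin a) (κ := Fin b) (X := ℝ)
      (fun _ _ => gaussianReal 0 1)
    simp only [Measure.infinitePi_eq_pi] at h
    exact h.symm
  have swap : (gaussianVector (Fin n × Fin k)).map (fun x (p : Fin k × Fin n) => x p.swap) =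
      gaussianVector (Fin k × Fin n) := by
    have h := Measure.pi_map_piCongrLeft (Equiv.prodComm (Fin n) (Fin k))
      (fun _ : Fin k × Fin n => gaussianReal 0 1)
    exact h
  rw [curry n k, curry k n, ← swap, Measure.map_map (by fun_prop) (by fun_prop),
    Measure.map_map (by fun_prop) (by fun_prop)]
  rfl

theorem gaussianVector_map_orthonormalBasis {n : ℕ}
    (u : OrthonormalBasis (Fin n) ℝ (EuclideanSpace ℝ (Fin n))) :
    (gaussianVector (Fin n)).map (fun x i => ∑ a, u i a * x a) = gaussianVector (Fin n) := by
  have h1 : (gaussianVector (Fin n)) =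
      (stdGaussian (EuclideanSpace ℝ (Fin n))).map WithLp.ofLp := by
    rw [← map_pi_eq_stdGaussian, Measure.map_map (by fun_prop) (by fun_prop)]
    exact Measure.map_id.symm
  conv_rhs => rw [h1, ← stdGaussian_map u.repr, ← map_pi_eq_stdGaussian]
  rw [Measure.map_map (by fun_prop) (by fun_prop), Measure.map_map (by fun_prop) (by fun_prop)]
  congr 1
  funext x i
  simp [OrthonormalBasis.repr_apply_apply, PiLp.inner_apply, mul_comm]

theorem gaussianVector_map_inner {n : ℕ} (z : EuclideanSpace ℝ (Fin n)) (hz : ‖z‖ = 1) :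
    (gaussianVector (Fin n)).map (fun x => ∑ a, z a * x a) = gaussianReal 0 1 := by
  have h := IsGaussian.map_eq_gaussianReal (μ := stdGaussian (EuclideanSpace ℝ (Fin n)))
    (innerSL ℝ z)
  rw [variance_dual_stdGaussian, integral_strongDual_stdGaussian, innerSL_apply_norm, hz,
    ← map_pi_eq_stdGaussian, Measure.map_map (by fun_prop) (by fun_prop)] at h
  simp only [one_pow, Real.toNNReal_one] at h
  rw [← h]
  congr 1
  funext x
  simp [PiLp.inner_apply, mul_comm]

theorem gaussianMatrix_map_mulVec {n k : ℕ} (w : EuclideanSpace ℝ (Fin k)) (hw : ‖w‖ = 1) :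
    (gaussianMatrix n k).map (fun S a => ∑ b, w b * S a b) = gaussianVector (Fin n) := by
  have : ∀ _ : Fin n, SigmaFinite ((gaussianVector (Fin k)).map fun x => ∑ b, w b * x b) := by
    intro _
    rw [gaussianVector_map_inner w hw]
    infer_instance
  have h := Measure.pi_map_pi (ι := Fin n) (μ := fun _ => gaussianVector (Fin k))
    (f := fun _ x => ∑ b, w b * x b)
    (fun _ => (by fun_prop : Measurable fun x : Fin k → ℝ => ∑ b, w b * x b).aemeasurable)
  simp only [gaussianVector_map_inner w hw] at h
  exact h

theorem gaussianMatrix_map_vecMul {n k : ℕ} (z : EuclideanSpace ℝ (Fin n)) (hz : ‖z‖ = 1) :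
    (gaussianMatrix n k).map (fun S b => ∑ a, z a * S a b) = gaussianVector (Fin k) := by
  rw [← gaussianMatrix_map_mulVec z hz, ← gaussianMatrix_map_transpose n k,
    Measure.map_map (by fun_prop) (by fun_prop)]
  rfl

theorem lintegral_pi_prod {ι X : Type*} [Fintype ι] [MeasurableSpace X] (μ : Measure X)
    [IsProbabilityMeasure μ] (f : ι → X → ENNReal) (hf : ∀ i, Measurable (f i)) :
    ∫⁻ x, ∏ i, f i (x i) ∂(Measure.pi fun _ : ι => μ) = ∏ i, ∫⁻ y, f i y ∂μ := by
  have hind : iIndepFun (fun i (x : ι → X) => f i (x i)) (Measure.pi fun _ : ι => μ) :=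
    iIndepFun_pi (fun i => (hf i).aemeasurable)
  have h := lintegral_prod_eq_prod_lintegral_of_indepFun Finset.univ
    (fun i (x : ι → X) => f i (x i)) hind (fun i => by fun_prop)
  refine h.trans (Finset.prod_congr rfl fun i _ => ?_)
  exact (measurePreserving_eval (fun _ : ι => μ) i).lintegral_comp (hf i)

theorem lintegral_exp_sq_gaussianReal {x : ℝ} (hx : x < 1 / 2) :
    ∫⁻ t, ENNReal.ofReal (Real.exp (x * t ^ 2)) ∂(gaussianReal 0 1) =
      ENNReal.ofReal ((√(1 - 2 * x))⁻¹) := by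
  have hb : 0 < 1 / 2 - x := by linarith
  rw [gaussianReal_of_var_ne_zero 0 one_ne_zero,
    lintegral_withDensity_eq_lintegral_mul _ (measurable_gaussianPDF 0 1) (by fun_prop)]
  have hfun : ∀ t : ℝ, (gaussianPDF 0 1 * fun t => ENNReal.ofReal (Real.exp (x * t ^ 2))) t =
      ENNReal.ofReal ((√(2 * Real.pi))⁻¹ * Real.exp (-(1 / 2 - x) * t ^ 2)) := by
    intro t
    rw [Pi.mul_apply, gaussianPDF, ← ENNReal.ofReal_mul (gaussianPDFReal_nonneg _ _ _),
      gaussianPDFReal, mul_assoc, ← Real.exp_add]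
    congr 3
    · simp
    · simp only [NNReal.coe_one]; ring
  simp_rw [hfun]
  rw [← ofReal_integral_eq_lintegral_ofReal ((integrable_exp_neg_mul_sq hb).const_mul _)
    (Filter.Eventually.of_forall fun t => by positivity), integral_const_mul, integral_gaussian,
    ← Real.sqrt_inv, ← Real.sqrt_inv, ← Real.sqrt_mul (by positivity)]
  congr 2
  have : 1 - 2 * x ≠ 0 := by linarith
  have : 1 / 2 - x ≠ 0 := hb.ne'
  have : Real.pi ≠ 0 := Real.pi_ne_zero
  field_simp

/-- A centred `χ²` variable is sub-Gaussian for small exponents. -/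
theorem lintegral_exp_sq_sub_one_le {x : ℝ} (hx : |x| ≤ 1 / 4) :
    ∫⁻ t, ENNReal.ofReal (Real.exp (x * (t ^ 2 - 1))) ∂(gaussianReal 0 1) ≤
      ENNReal.ofReal (Real.exp (4 * x ^ 2)) := by
  obtain ⟨h1, h2⟩ := abs_le.mp hx
  have hpos : 0 < 1 - 2 * x := by linarith
  have hsplit : ∀ t : ℝ, ENNReal.ofReal (Real.exp (x * (t ^ 2 - 1))) =
      ENNReal.ofReal (Real.exp (-x)) * ENNReal.ofReal (Real.exp (x * t ^ 2)) := by
    intro t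
    rw [← ENNReal.ofReal_mul (Real.exp_nonneg _), ← Real.exp_add]
    congr 2; ring
  simp_rw [hsplit]
  rw [lintegral_const_mul _ (by fun_prop), lintegral_exp_sq_gaussianReal (by linarith),
    ← ENNReal.ofReal_mul (Real.exp_nonneg _)]
  refine ENNReal.ofReal_le_ofReal ?_
  have hlog := Real.abs_log_sub_add_sum_range_le (x := 2 * x) (by rw [abs_mul, abs_two]; linarith) 1
  have hden : |2 * x| ^ (1 + 1) / (1 - |2 * x|) ≤ 8 * x ^ 2 := by
    rw [div_le_iff₀ (by rw [abs_mul, abs_two]; linarith)]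
    rw [sq_abs, abs_mul, abs_two]
    nlinarith [sq_nonneg x]
  have hlow := (abs_le.mp (hlog.trans hden)).1
  simp only [Finset.sum_range_one, zero_add, pow_one, Nat.cast_zero, div_one] at hlow
  have hs : (√(1 - 2 * x))⁻¹ = Real.exp (-(Real.log (1 - 2 * x) / 2)) := by
    rw [Real.exp_neg, ← Real.log_sqrt hpos.le, Real.exp_log (Real.sqrt_pos.mpr hpos)]
  rw [hs, ← Real.exp_add]
  exact Real.exp_le_exp.mpr (by linarith)

/-- The Chernoff bound, for events and random variables that need not be measurable. -/
theorem measure_le_exp_of_lintegral_exp_le {Ω : Type*} [MeasurableSpace Ω] (μ : Measure Ω)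
    (f : Ω → ℝ) (hf : Measurable f) {c a : ℝ} {E : Set Ω} (hE : ∀ ω ∈ E, a ≤ f ω)
    (h : ∫⁻ ω, ENNReal.ofReal (Real.exp (f ω)) ∂μ ≤ ENNReal.ofReal (Real.exp c)) :
    μ E ≤ ENNReal.ofReal (Real.exp (c - a)) := by
  have h1 : μ E ≤ μ {ω | ENNReal.ofReal (Real.exp a) ≤ ENNReal.ofReal (Real.exp (f ω))} :=
    measure_mono fun ω hω => ENNReal.ofReal_le_ofReal (Real.exp_le_exp.mpr (hE ω hω))
  have h2 := mul_meas_ge_le_lintegral (μ := μ)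
    (f := fun ω => ENNReal.ofReal (Real.exp (f ω))) (by fun_prop) (ENNReal.ofReal (Real.exp a))
  have h3 : ENNReal.ofReal (Real.exp a) * μ E ≤ ENNReal.ofReal (Real.exp c) :=
    (mul_le_mul_right h1 _).trans (h2.trans h)
  have h4 : ENNReal.ofReal (Real.exp (c - a)) =
      ENNReal.ofReal (Real.exp (-a)) * ENNReal.ofReal (Real.exp c) := by
    rw [← ENNReal.ofReal_mul (Real.exp_nonneg _), ← Real.exp_add]; congr 2; ring
  have h5 : ENNReal.ofReal (Real.exp (-a)) * ENNReal.ofReal (Real.exp a) = 1 := by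
    rw [← ENNReal.ofReal_mul (Real.exp_nonneg _), ← Real.exp_add]; simp
  rw [h4]
  calc μ E = ENNReal.ofReal (Real.exp (-a)) * (ENNReal.ofReal (Real.exp a) * μ E) := by
        rw [← mul_assoc, h5, one_mul]
    _ ≤ _ := mul_le_mul_right h3 _

/-! ### Extreme singular values of Gaussian matrices -/

/-- A volumetric substitute for a union bound over a net: if every bad outcome comes with a whole
ball of points `z` at which the event `H` occurs, then averaging over `z` bounds the
probability of a bad outcome by the probability of `H` at a fixed point, times a ratio of
volumes. -/
theorem measure_le_of_exists_ball {Ω ι : Type*} [MeasurableSpace Ω] [Fintype ι] (μ : Measure Ω)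
    [IsProbabilityMeasure μ] {H : Set (Ω × EuclideanSpace ℝ ι)} (hH : MeasurableSet H)
    {p : ENNReal} (hp : ∀ z, μ {ω | (ω, z) ∈ H} ≤ p) {ρ R : ℝ} (hρ : 0 < ρ) (hR : 0 < R)
    {E : Set Ω}
    (hE : ∀ ω ∈ E, ∃ e, Metric.ball e ρ ⊆ Metric.ball 0 R ∧ ∀ z ∈ Metric.ball e ρ, (ω, z) ∈ H) :
    μ E ≤ ENNReal.ofReal ((R / ρ) ^ Fintype.card ι) * p := by
  set ν : Measure (EuclideanSpace ℝ ι) := volume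
  set V := ν (Metric.ball 0 ρ)
  have hV0 : V ≠ 0 := (Metric.measure_ball_pos ν 0 hρ).ne'
  have hVtop : V ≠ ⊤ := measure_ball_lt_top.ne
  have hVR : ν (Metric.ball 0 R) = ENNReal.ofReal ((R / ρ) ^ Fintype.card ι) * V := by
    have h := Measure.addHaar_ball_mul_of_pos ν (0 : EuclideanSpace ℝ ι) (div_pos hR hρ) ρ
    rwa [div_mul_cancel₀ _ hρ.ne', finrank_euclideanSpace] at h
  set ν' := ν.restrict (Metric.ball 0 R)
  have hsec : ∀ ω ∈ E, V ≤ ν' (Prod.mk ω ⁻¹' H) := by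
    intro ω hω
    obtain ⟨e, he, hz⟩ := hE ω hω
    calc V = ν (Metric.ball e ρ) := (Measure.addHaar_ball_center ν e ρ).symm
      _ ≤ ν (Prod.mk ω ⁻¹' H ∩ Metric.ball 0 R) := measure_mono fun z hzb => ⟨hz z hzb, he hzb⟩
      _ = _ := (Measure.restrict_apply (measurable_prodMk_left hH)).symm
  have h1 : V * μ E ≤ ∫⁻ ω, ν' (Prod.mk ω ⁻¹' H) ∂μ :=
    (mul_le_mul_right (measure_mono hsec) _).trans
      (mul_meas_ge_le_lintegral (measurable_measure_prodMk_left hH) V)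
  have h2 : ∫⁻ ω, ν' (Prod.mk ω ⁻¹' H) ∂μ ≤ p * ν (Metric.ball 0 R) := by
    rw [← Measure.prod_apply hH, Measure.prod_apply_symm hH]
    calc ∫⁻ z, μ ((fun ω => (ω, z)) ⁻¹' H) ∂ν' ≤ ∫⁻ _, p ∂ν' := lintegral_mono fun z => hp z
      _ = _ := by rw [lintegral_const, Measure.restrict_apply_univ]
  have h3 : V * μ E ≤ V * (ENNReal.ofReal ((R / ρ) ^ Fintype.card ι) * p) := by
    refine (h1.trans h2).trans_eq ?_
    rw [hVR]; ring
  exact (ENNReal.mul_le_mul_iff_right hV0 hVtop).mp h3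

/-- If `‖L‖ ^ 2` exceeds `81 / 4 * M = (3 * 3 / 2) ^ 2 * M`, then `‖L z‖ ≥ ‖L‖ / 3` on a ball of
radius `1 / 2` about a nearly maximizing unit vector, where `‖z‖ ≤ 3 / 2`. -/
theorem exists_ball_of_lt_norm_sq {E F : Type*} [NormedAddCommGroup E] [NormedSpace ℝ E]
    [NormedAddCommGroup F] [NormedSpace ℝ F] (L : E →L[ℝ] F) {M : ℝ} (hM : 0 ≤ M)
    (h : ∃ w, 81 / 4 * M * ‖w‖ ^ 2 < ‖L w‖ ^ 2) :
    ∃ e, Metric.ball e (1 / 2) ⊆ Metric.ball 0 (3 / 2) ∧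
      ∀ z ∈ Metric.ball e (1 / 2 : ℝ), 0 < ‖z‖ ∧ M * ‖z‖ ^ 2 ≤ ‖L z‖ ^ 2 := by
  obtain ⟨w, hw⟩ := h
  have hL : 81 / 4 * M < ‖L‖ ^ 2 := by
    by_contra hcon
    have h1 : ‖L w‖ ^ 2 ≤ (‖L‖ * ‖w‖) ^ 2 := by gcongr; exact L.le_opNorm w
    nlinarith [sq_nonneg ‖w‖]
  have hL0 : 0 < ‖L‖ := by
    rcases (norm_nonneg L).eq_or_lt with h0 | h0
    · rw [← h0] at hL; linarith
    · exact h0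
  obtain ⟨e, he1, he2⟩ := L.exists_lt_apply_of_lt_opNorm (r := 5 / 6 * ‖L‖) (by linarith)
  have hball : ∀ z ∈ Metric.ball e (1 / 2 : ℝ), ‖z‖ < 3 / 2 := by
    intro z hz
    have h1 : ‖z - e‖ < 1 / 2 := by rwa [mem_ball_iff_norm] at hz
    have h2 := norm_add_le (z - e) e
    rw [sub_add_cancel] at h2
    linarith
  refine ⟨e, fun z hz => by simpa using hball z hz, fun z hz => ?_⟩
  have h1 : ‖e - z‖ < 1 / 2 := by rwa [mem_ball_iff_norm'] at hz
  have h2 : ‖L e‖ ≤ ‖L (e - z)‖ + ‖L z‖ := by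
    have := norm_add_le (L (e - z)) (L z)
    rwa [← map_add, sub_add_cancel] at this
  have h3 : ‖L (e - z)‖ ≤ ‖L‖ * (1 / 2) := (L.le_opNorm _).trans (by gcongr)
  have h4 : ‖L‖ / 3 ≤ ‖L z‖ := by linarith
  have h5 : 0 < ‖z‖ := by
    rw [norm_pos_iff]
    rintro rfl
    simp only [map_zero, norm_zero] at h4
    linarith
  have h6 : (‖L‖ / 3) ^ 2 ≤ ‖L z‖ ^ 2 := by gcongr
  have h7 : ‖z‖ ^ 2 ≤ (3 / 2) ^ 2 := by gcongr; exact (hball z hz).le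
  exact ⟨h5, by nlinarith⟩

/-- The product `u_iᵀ S` of a basis vector and a sample matrix. -/
noncomputable def sketchRow {n k : ℕ} (u : OrthonormalBasis (Fin n) ℝ (EuclideanSpace ℝ (Fin n)))
    (S : Fin n → Fin k → ℝ) (i : Fin n) : EuclideanSpace ℝ (Fin k) :=
  WithLp.toLp 2 fun b => ∑ a, u i a * S a b

section

variable {n k : ℕ} (u : OrthonormalBasis (Fin n) ℝ (EuclideanSpace ℝ (Fin n)))

theorem inner_sketchRow (S : Fin n → Fin k → ℝ) (i : Fin n) (w : EuclideanSpace ℝ (Fin k)) :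
    inner ℝ (sketchRow u S i) w = ∑ a, u i a * ∑ b, w b * S a b := by
  simp only [sketchRow, PiLp.inner_apply, RCLike.inner_apply, conj_trivial, Finset.mul_sum]
  rw [Finset.sum_comm]
  exact Finset.sum_congr rfl fun a _ => Finset.sum_congr rfl fun b _ => by ring

theorem measurable_inner_sketchRow (i : Fin n) :
    Measurable fun p : (Fin n → Fin k → ℝ) × EuclideanSpace ℝ (Fin k) =>
      inner ℝ (sketchRow u p.1 i) p.2 := by
  simp only [inner_sketchRow]
  fun_prop

theorem measurable_sketchRow_inner (w : EuclideanSpace ℝ (Fin k)) :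
    Measurable fun (S : Fin n → Fin k → ℝ) i => inner ℝ (sketchRow u S i) w := by
  simp only [inner_sketchRow]
  fun_prop

theorem gaussianMatrix_map_inner_sketchRow {w : EuclideanSpace ℝ (Fin k)} (hw : ‖w‖ = 1) :
    (gaussianMatrix n k).map (fun S i => inner ℝ (sketchRow u S i) w) =
      gaussianVector (Fin n) := by
  rw [← gaussianVector_map_orthonormalBasis u, ← gaussianMatrix_map_mulVec w hw,
    Measure.map_map (by fun_prop) (by fun_prop)]
  simp only [inner_sketchRow]
  rfl

theorem lintegral_exp_weighted_sq_le {ι : Type*} [Fintype ι] {q : ι → ℝ} (h0 : ∀ i, 0 ≤ q i)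
    (h1 : ∀ i, q i ≤ 1) :
    ∫⁻ x, ENNReal.ofReal (Real.exp (1 / 4 * ∑ i, q i * x i ^ 2)) ∂(gaussianVector ι) ≤
      ENNReal.ofReal (Real.exp (1 / 2 * ∑ i, q i)) := by
  have hterm : ∀ i, ∫⁻ t, ENNReal.ofReal (Real.exp (q i / 4 * t ^ 2)) ∂(gaussianReal 0 1) ≤
      ENNReal.ofReal (Real.exp (1 / 2 * q i)) := by
    intro i
    have hq := lintegral_exp_sq_sub_one_le (x := q i / 4)
      (by rw [abs_of_nonneg (by linarith [h0 i])]; linarith [h1 i])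
    have hs : ∀ t : ℝ, ENNReal.ofReal (Real.exp (q i / 4 * t ^ 2)) =
        ENNReal.ofReal (Real.exp (q i / 4)) *
          ENNReal.ofReal (Real.exp (q i / 4 * (t ^ 2 - 1))) := by
      intro t
      rw [← ENNReal.ofReal_mul (Real.exp_nonneg _), ← Real.exp_add]
      congr 2; ring
    simp_rw [hs]
    rw [lintegral_const_mul _ (by fun_prop)]
    refine (mul_le_mul_right hq _).trans ?_
    rw [← ENNReal.ofReal_mul (Real.exp_nonneg _), ← Real.exp_add]
    refine ENNReal.ofReal_le_ofReal (Real.exp_le_exp.mpr ?_)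
    nlinarith [h0 i, h1 i]
  have hprod : ∀ x : ι → ℝ, ENNReal.ofReal (Real.exp (1 / 4 * ∑ i, q i * x i ^ 2)) =
      ∏ i, ENNReal.ofReal (Real.exp (q i / 4 * x i ^ 2)) := by
    intro x
    rw [← ENNReal.ofReal_prod_of_nonneg (fun i _ => Real.exp_nonneg _), ← Real.exp_sum,
      Finset.mul_sum]
    congr 3; ext i; ring
  simp_rw [hprod]
  rw [lintegral_pi_prod _ (fun i t => ENNReal.ofReal (Real.exp (q i / 4 * t ^ 2)))
    (fun i => by fun_prop), Finset.mul_sum, Real.exp_sum,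
    ENNReal.ofReal_prod_of_nonneg (fun i _ => Real.exp_nonneg _)]
  exact Finset.prod_le_prod' fun i _ => hterm i

/-- The weighted Gaussian matrix with rows `√q_i • u_iᵀ S` has squared operator norm of order
`k`, up to an exponentially small probability. -/
theorem gaussianMatrix_weighted_norm_le {q : Fin n → ℝ} (h0 : ∀ i, 0 ≤ q i)
    (h1 : ∀ i, q i ≤ 1) (hq : ∑ i, q i ≤ k) :
    gaussianMatrix n k {S | ∃ w : EuclideanSpace ℝ (Fin k),
        243 * k * ‖w‖ ^ 2 < ∑ i, q i * inner ℝ (sketchRow u S i) w ^ 2} ≤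
      ENNReal.ofReal (Real.exp (-k)) := by
  set Φ : (Fin n → Fin k → ℝ) × EuclideanSpace ℝ (Fin k) → ℝ :=
    fun p => ∑ i, q i * inner ℝ (sketchRow u p.1 i) p.2 ^ 2 with hΦ
  have hΦm : Measurable Φ := Finset.measurable_sum _ fun i _ =>
    ((measurable_inner_sketchRow u i).pow_const 2).const_mul _
  have hunit : ∀ w : EuclideanSpace ℝ (Fin k), ‖w‖ = 1 →
      gaussianMatrix n k {S | 12 * k ≤ Φ (S, w)} ≤ ENNReal.ofReal (Real.exp (-(5 / 2) * k)) := by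
    intro w hw
    have hrow := measurable_sketchRow_inner u w
    have hmeas : Measurable fun S : Fin n → Fin k → ℝ => Φ (S, w) :=
      Finset.measurable_sum _ fun i _ =>
        (((measurable_pi_apply i).comp hrow).pow_const 2).const_mul _
    have hint : ∫⁻ S, ENNReal.ofReal (Real.exp (1 / 4 * Φ (S, w))) ∂(gaussianMatrix n k) ≤
        ENNReal.ofReal (Real.exp (1 / 2 * k)) := by
      calc ∫⁻ S, ENNReal.ofReal (Real.exp (1 / 4 * Φ (S, w))) ∂(gaussianMatrix n k)
          = ∫⁻ x, ENNReal.ofReal (Real.exp (1 / 4 * ∑ i, q i * x i ^ 2))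
              ∂(gaussianVector (Fin n)) := by
            rw [← gaussianMatrix_map_inner_sketchRow (k := k) u hw,
              lintegral_map (by fun_prop) hrow]
        _ ≤ ENNReal.ofReal (Real.exp (1 / 2 * ∑ i, q i)) := lintegral_exp_weighted_sq_le h0 h1
        _ ≤ _ := ENNReal.ofReal_le_ofReal (Real.exp_le_exp.mpr (by linarith))
    refine (measure_le_exp_of_lintegral_exp_le _ _ (hmeas.const_mul _) (a := 3 * k)
      (fun S (hS : 12 * (k : ℝ) ≤ Φ (S, w)) => ?_) hint).trans_eq ?_
    · linarith
    · congr 2; ring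
  set H : Set ((Fin n → Fin k → ℝ) × EuclideanSpace ℝ (Fin k)) :=
    {p | 0 < ‖p.2‖ ∧ 12 * k * ‖p.2‖ ^ 2 ≤ Φ p}
  have hHm : MeasurableSet H :=
    (measurableSet_lt measurable_const measurable_snd.norm).inter
      (measurableSet_le (by fun_prop) hΦm)
  have hHp : ∀ z, gaussianMatrix n k {S | (S, z) ∈ H} ≤
      ENNReal.ofReal (Real.exp (-(5 / 2) * k)) := by
    intro z
    by_cases hz : 0 < ‖z‖
    · refine (measure_mono fun S hS => ?_).trans
        (hunit (‖z‖⁻¹ • z) (by rw [norm_smul, norm_inv, norm_norm, inv_mul_cancel₀ hz.ne']))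
      have hS2 : 12 * k * ‖z‖ ^ 2 ≤ Φ (S, z) := hS.2
      have hscale : Φ (S, ‖z‖⁻¹ • z) = (‖z‖ ^ 2)⁻¹ * Φ (S, z) := by
        simp only [hΦ, inner_smul_right, Finset.mul_sum]
        exact Finset.sum_congr rfl fun i _ => by ring
      change 12 * (k : ℝ) ≤ Φ (S, ‖z‖⁻¹ • z)
      rw [hscale, ← div_eq_inv_mul, le_div_iff₀ (by positivity)]
      exact hS2
    · have : {S | (S, z) ∈ H} = ∅ := by
        ext S; simp only [Set.mem_ofPred_eq, Set.mem_empty_iff_false, iff_false]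
        exact fun h => hz h.1
      simp [this]
  have hvol := measure_le_of_exists_ball (gaussianMatrix n k) hHm hHp (ρ := 1 / 2) (R := 3 / 2)
    (by norm_num) (by norm_num) (E := {S | ∃ w : EuclideanSpace ℝ (Fin k),
        243 * k * ‖w‖ ^ 2 < ∑ i, q i * inner ℝ (sketchRow u S i) w ^ 2}) ?_
  · refine hvol.trans ?_
    rw [Fintype.card_fin, ← ENNReal.ofReal_mul (by positivity)]
    refine ENNReal.ofReal_le_ofReal ?_
    have h3 : (3 / 2 / (1 / 2) : ℝ) ≤ Real.exp (3 / 2) := by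
      have := Real.quadratic_le_exp_of_nonneg (x := 3 / 2) (by norm_num)
      norm_num at this ⊢
      linarith
    calc (3 / 2 / (1 / 2) : ℝ) ^ k * Real.exp (-(5 / 2) * k)
        ≤ Real.exp (3 / 2) ^ k * Real.exp (-(5 / 2) * k) := by gcongr
      _ = Real.exp (-k) := by rw [← Real.exp_nat_mul, ← Real.exp_add]; congr 1; ring
  · intro S hS
    set L : EuclideanSpace ℝ (Fin k) →L[ℝ] EuclideanSpace ℝ (Fin n) :=
      LinearMap.toContinuousLinearMap
        { toFun := fun w => WithLp.toLp 2 fun i => √(q i) * inner ℝ (sketchRow u S i) w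
          map_add' := fun w w' => by ext i; simp [inner_add_right, mul_add]
          map_smul' := fun c w => by ext i; simp [inner_smul_right]; ring } with hLdef
    have hL : ∀ w, ‖L w‖ ^ 2 = Φ (S, w) := by
      intro w
      rw [EuclideanSpace.real_norm_sq_eq]
      refine Finset.sum_congr rfl fun i _ => ?_
      change (√(q i) * inner ℝ (sketchRow u S i) w) ^ 2 = _
      rw [mul_pow, Real.sq_sqrt (h0 i)]
    obtain ⟨w, hw⟩ := hS
    obtain ⟨e, he, hz⟩ := exists_ball_of_lt_norm_sq L (M := 12 * k) (by positivity)
      ⟨w, by rw [hL]; refine lt_of_eq_of_lt ?_ hw; ring⟩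
    refine ⟨e, he, fun z hzb => ?_⟩
    have := hz z hzb
    rw [hL] at this
    exact this

/-- The bound for a matrix with rows `d_i • ω_i`, transferred to its transpose. -/
theorem norm_sum_smul_sq_le {ι E : Type*} [Fintype ι] [NormedAddCommGroup E]
    [InnerProductSpace ℝ E] {d : ι → ℝ} {ω : ι → E} {M : ℝ} (hM : 0 ≤ M)
    (h : ∀ w, ∑ i, d i ^ 2 * inner ℝ (ω i) w ^ 2 ≤ M * ‖w‖ ^ 2) (y : ι → ℝ) :
    ‖∑ i, (y i * d i) • ω i‖ ^ 2 ≤ M * ∑ i, y i ^ 2 := by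
  set w := ∑ i, (y i * d i) • ω i with hw
  have h1 : ‖w‖ ^ 2 = ∑ i, y i * (d i * inner ℝ (ω i) w) := by
    rw [← real_inner_self_eq_norm_sq]
    conv_lhs => rw [hw, sum_inner]
    exact Finset.sum_congr rfl fun i _ => by rw [real_inner_smul_left]; ring
  have h2 := Finset.sum_mul_sq_le_sq_mul_sq Finset.univ y
    (fun i => d i * inner ℝ (ω i) w)
  rw [← h1] at h2
  simp only [mul_pow (d _)] at h2
  have hy : 0 ≤ ∑ i, y i ^ 2 := Finset.sum_nonneg fun i _ => sq_nonneg _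
  by_cases hw0 : ‖w‖ = 0
  · rw [hw0]
    have h4 : 0 ≤ M * ∑ i, y i ^ 2 := by positivity
    simpa using h4
  · have hpos : 0 < ‖w‖ ^ 2 := by positivity
    have h5 : ‖w‖ ^ 2 * ‖w‖ ^ 2 ≤ (M * ∑ i, y i ^ 2) * ‖w‖ ^ 2 := by
      calc ‖w‖ ^ 2 * ‖w‖ ^ 2 = (‖w‖ ^ 2) ^ 2 := by ring
        _ ≤ _ := h2
        _ ≤ (∑ i, y i ^ 2) * (M * ‖w‖ ^ 2) := by gcongr; exact h w
        _ = _ := by ring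
    exact le_of_mul_le_mul_right h5 hpos

end

section

variable {n k : ℕ} (u : OrthonormalBasis (Fin n) ℝ (EuclideanSpace ℝ (Fin n)))

theorem sum_smul_sketchRow_apply (I : Finset (Fin n)) (S : Fin n → Fin k → ℝ)
    (z : EuclideanSpace ℝ I) (b : Fin k) :
    (∑ i : I, z i • sketchRow u S i) b = ∑ a, (∑ i : I, z i • u i) a * S a b := by
  simp only [sketchRow, PiLp.smul_apply, smul_eq_mul, WithLp.ofLp_sum, Finset.sum_apply,
    Finset.mul_sum, Finset.sum_mul]
  rw [Finset.sum_comm]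
  exact Finset.sum_congr rfl fun a _ => Finset.sum_congr rfl fun i _ => by ring

/-- A unit combination of the rows `u_iᵀ S` is a standard Gaussian vector in `ℝᵏ`. -/
theorem lintegral_exp_neg_norm_sq_sum_sketchRow (I : Finset (Fin n)) {x : ℝ} (hx : 0 ≤ x)
    {z : EuclideanSpace ℝ I} (hz : ‖z‖ = 1) :
    ∫⁻ S, ENNReal.ofReal (Real.exp (-x * ‖∑ i : I, z i • sketchRow u S i‖ ^ 2))
      ∂(gaussianMatrix n k) = ENNReal.ofReal (Real.exp (-(k / 2 * Real.log (1 + 2 * x)))) := by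
  set Z : EuclideanSpace ℝ (Fin n) := ∑ i : I, z i • u i with hZdef
  have hZ : ‖Z‖ = 1 := by
    have h1 : ‖Z‖ ^ 2 = 1 := by
      have hu : Orthonormal ℝ fun i : I => u i :=
        u.orthonormal.comp _ Subtype.val_injective
      rw [← real_inner_self_eq_norm_sq, hZdef, hu.inner_sum]
      have := EuclideanSpace.real_norm_sq_eq z
      rw [hz] at this
      simp only [conj_trivial, ← pow_two]
      linarith
    nlinarith [norm_nonneg Z]
  have hprod : ∀ S : Fin n → Fin k → ℝ,
      ENNReal.ofReal (Real.exp (-x * ‖∑ i : I, z i • sketchRow u S i‖ ^ 2)) =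
      ∏ b, ENNReal.ofReal (Real.exp (-x * (∑ a, Z a * S a b) ^ 2)) := by
    intro S
    rw [← ENNReal.ofReal_prod_of_nonneg (fun i _ => Real.exp_nonneg _), ← Real.exp_sum,
      EuclideanSpace.real_norm_sq_eq, Finset.mul_sum]
    simp only [sum_smul_sketchRow_apply, hZdef]
  simp_rw [hprod]
  have hmap := lintegral_map (μ := gaussianMatrix n k)
    (f := fun y : Fin k → ℝ => ∏ b, ENNReal.ofReal (Real.exp (-x * y b ^ 2)))
    (g := fun S b => ∑ a, Z a * S a b) (by fun_prop) (by fun_prop)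
  rw [gaussianMatrix_map_vecMul Z hZ] at hmap
  rw [← hmap, lintegral_pi_prod _ (fun _ t => ENNReal.ofReal (Real.exp (-x * t ^ 2)))
    (fun i => by fun_prop), Finset.prod_const, lintegral_exp_sq_gaussianReal (by linarith),
    ← ENNReal.ofReal_pow (by positivity)]
  congr 1
  have hpos : 0 < 1 + 2 * x := by linarith
  have h2 : 1 - 2 * -x = 1 + 2 * x := by ring
  rw [h2, Finset.card_univ, Fintype.card_fin,
    show -(k / 2 * Real.log (1 + 2 * x)) = k * -(Real.log (1 + 2 * x) / 2) by ring,
    Real.exp_nat_mul, Real.exp_neg, ← Real.log_sqrt hpos.le,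
    Real.exp_log (Real.sqrt_pos.mpr hpos)]

/-- A fixed family of at most `k / 2` of the Gaussian vectors `ω_i = u_iᵀ S` in dimension `k` has
smallest singular value at least of order `√k`, up to an exponentially small probability. -/
theorem gaussianMatrix_le_norm_sum_sq : ∃ η : ℝ, 0 < η ∧
    ∀ {n k : ℕ} (u : OrthonormalBasis (Fin n) ℝ (EuclideanSpace ℝ (Fin n)))
      (I : Finset (Fin n)), 2 * I.card ≤ k →
    gaussianMatrix n k {S | ∃ c : EuclideanSpace ℝ I,
        ‖∑ i : I, c i • sketchRow u S i‖ ^ 2 < η * k * ‖c‖ ^ 2} ≤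
      ENNReal.ofReal (2 * Real.exp (-k)) := by
  -- `ρ = 1 / 200000` is the radius of the balls and `η = 243 ρ²`: moving by `ρ` changes the norm of
  -- the combination by at most `√(243 k) ρ = √(η k)`, and the volume factor `(2 / ρ) ^ (k / 2)` is
  -- beaten by the small ball probability `(e / (1 + 1 / (16 η))) ^ (k / 2)`, as `η` has order `ρ²`.
  set η : ℝ := 243 / (4 * 10 ^ 10) with hη
  refine ⟨η, by norm_num [hη], fun {n k} u I hI => ?_⟩
  set q : Fin n → ℝ := fun i => if i ∈ I then 1 else 0 with hq
  have hq0 : ∀ i, 0 ≤ q i := fun i => by simp only [hq]; split_ifs <;> norm_num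
  have hq1 : ∀ i, q i ≤ 1 := fun i => by simp only [hq]; split_ifs <;> norm_num
  have hcard : (2 * I.card : ℝ) ≤ k := by exact_mod_cast hI
  have hqs : ∑ i, q i ≤ k := by
    simp only [hq, Finset.sum_ite_mem, Finset.univ_inter, Finset.sum_const, nsmul_eq_mul, mul_one]
    have : (0 : ℝ) ≤ I.card := by positivity
    linarith
  set U : Set (Fin n → Fin k → ℝ) := {S | ∃ w : EuclideanSpace ℝ (Fin k),
        243 * k * ‖w‖ ^ 2 < ∑ i, q i * inner ℝ (sketchRow u S i) w ^ 2} with hU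
  have hUle : gaussianMatrix n k U ≤ ENNReal.ofReal (Real.exp (-k)) :=
    gaussianMatrix_weighted_norm_le u hq0 hq1 hqs
  have hup : ∀ S ∉ U, ∀ c : EuclideanSpace ℝ I,
      ‖∑ i : I, c i • sketchRow u S i‖ ^ 2 ≤ 243 * k * ‖c‖ ^ 2 := by
    intro S hS c
    have h := norm_sum_smul_sq_le (d := fun _ : I => (1 : ℝ))
      (ω := fun i : I => sketchRow u S i) (M := 243 * k) (by positivity) (fun w => ?_) c
    · simpa [EuclideanSpace.real_norm_sq_eq c] using h
    · by_contra hcon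
      refine hS ⟨w, (not_le.mp hcon).trans_eq ?_⟩
      simp only [hq, one_pow, ite_mul, zero_mul, one_mul, Finset.sum_ite_mem, Finset.univ_inter]
      exact Finset.sum_coe_sort I fun i => inner ℝ (sketchRow u S i) w ^ 2
  set Ψ : (Fin n → Fin k → ℝ) × EuclideanSpace ℝ I → ℝ :=
    fun p => ‖∑ i : I, p.2 i • sketchRow u p.1 i‖ ^ 2 with hΨ
  have hΨm : Measurable Ψ := by
    simp only [hΨ, EuclideanSpace.real_norm_sq_eq, sum_smul_sketchRow_apply]
    simp only [WithLp.ofLp_sum, Finset.sum_apply, PiLp.smul_apply]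
    fun_prop
  set H : Set ((Fin n → Fin k → ℝ) × EuclideanSpace ℝ I) :=
    {p | 0 < ‖p.2‖ ∧ Ψ p ≤ 16 * η * k * ‖p.2‖ ^ 2}
  have hHm : MeasurableSet H :=
    (measurableSet_lt measurable_const measurable_snd.norm).inter
      (measurableSet_le hΨm (by fun_prop))
  set p : ℝ := Real.exp (k / 2 - k / 2 * Real.log (1 + 1 / (16 * η)))
  have hη0 : 0 < η := by norm_num [hη]
  have hHp : ∀ z, gaussianMatrix n k {S | (S, z) ∈ H} ≤ ENNReal.ofReal p := by
    intro z
    by_cases hz : 0 < ‖z‖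
    · have hu : ‖‖z‖⁻¹ • z‖ = 1 := by rw [norm_smul, norm_inv, norm_norm, inv_mul_cancel₀ hz.ne']
      have hint := (lintegral_exp_neg_norm_sq_sum_sketchRow (k := k) u I (x := 1 / (32 * η))
        (by positivity) hu).le
      refine (measure_le_exp_of_lintegral_exp_le _
        (fun S => -(1 / (32 * η)) * Ψ (S, ‖z‖⁻¹ • z))
        ((hΨm.comp (measurable_id.prodMk measurable_const)).const_mul _) (a := -(k / 2))
        (fun S hS => ?_) hint).trans_eq ?_
      · have hS2 : Ψ (S, z) ≤ 16 * η * k * ‖z‖ ^ 2 := hS.2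
        have hscale : Ψ (S, ‖z‖⁻¹ • z) = (‖z‖ ^ 2)⁻¹ * Ψ (S, z) := by
          simp only [hΨ, PiLp.smul_apply, smul_eq_mul, ← smul_smul, ← Finset.smul_sum]
          rw [norm_smul, mul_pow, norm_inv, norm_norm, inv_pow]
        rw [hscale]
        have h3 : (‖z‖ ^ 2)⁻¹ * Ψ (S, z) ≤ 16 * η * k := by
          rw [← div_eq_inv_mul, div_le_iff₀ (by positivity)]; exact hS2
        have h4 : 1 / (32 * η) * ((‖z‖ ^ 2)⁻¹ * Ψ (S, z)) ≤ 1 / (32 * η) * (16 * η * k) := by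
          gcongr
        have h5 : 1 / (32 * η) * (16 * η * k) = k / 2 := by field_simp; ring
        linarith
      · congr 2
        rw [show 2 * (1 / (32 * η)) = 1 / (16 * η) by field_simp; norm_num]
        ring
    · have : {S | (S, z) ∈ H} = ∅ := by
        ext S; simp only [Set.mem_ofPred_eq, Set.mem_empty_iff_false, iff_false]
        exact fun h => hz h.1
      simp [this]
  set E : Set (Fin n → Fin k → ℝ) := {S | ∃ c : EuclideanSpace ℝ I,
        ‖∑ i : I, c i • sketchRow u S i‖ ^ 2 < η * k * ‖c‖ ^ 2} with hE
  set ρ : ℝ := 1 / 200000 with hρ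
  have hvol := measure_le_of_exists_ball (gaussianMatrix n k) hHm hHp (ρ := ρ) (R := 2)
    (by norm_num [hρ]) (by norm_num) (E := E \ U) ?_
  · have hnum : ENNReal.ofReal ((2 / ρ) ^ Fintype.card I) * ENNReal.ofReal p ≤
        ENNReal.ofReal (Real.exp (-k)) := by
      rw [← ENNReal.ofReal_mul (by positivity)]
      refine ENNReal.ofReal_le_ofReal ?_
      have h1 : (2 / ρ) ^ Fintype.card I = Real.exp (I.card * Real.log (2 / ρ)) := by
        rw [Real.exp_nat_mul, Real.exp_log (by norm_num [hρ]), Fintype.card_coe]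
      rw [h1, ← Real.exp_add, Real.exp_le_exp]
      have hl0 : 0 ≤ Real.log (2 / ρ) := Real.log_nonneg (by norm_num [hρ])
      have hl1 : Real.log (2 / ρ) + 3 ≤ Real.log (1 + 1 / (16 * η)) := by
        rw [Real.le_log_iff_exp_le (by positivity), Real.exp_add,
          Real.exp_log (by norm_num [hρ])]
        have h3 : Real.exp 3 ≤ 21 := by
          have h := Real.exp_one_lt_d9
          have : Real.exp 3 = Real.exp 1 ^ 3 := by rw [← Real.exp_nat_mul]; norm_num
          rw [this]
          calc Real.exp 1 ^ 3 ≤ 2.7182818286 ^ 3 := by gcongr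
            _ ≤ 21 := by norm_num
        calc 2 / ρ * Real.exp 3 ≤ 2 / ρ * 21 := by
              gcongr
          _ ≤ _ := by norm_num [hρ, hη]
      have hk0 : (0 : ℝ) ≤ k := by positivity
      nlinarith
    calc gaussianMatrix n k E ≤ gaussianMatrix n k (U ∪ E \ U) :=
          measure_mono (by rw [Set.union_sdiff_self]; exact Set.subset_union_right)
      _ ≤ gaussianMatrix n k U + gaussianMatrix n k (E \ U) := measure_union_le _ _
      _ ≤ ENNReal.ofReal (Real.exp (-k)) + ENNReal.ofReal (Real.exp (-k)) :=
          add_le_add hUle (hvol.trans hnum)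
      _ = ENNReal.ofReal (2 * Real.exp (-k)) := by
          rw [← ENNReal.ofReal_add (Real.exp_nonneg _) (Real.exp_nonneg _)]; congr 1; ring
  · rintro S ⟨⟨c, hc⟩, hSU⟩
    have hc0 : 0 < ‖c‖ := by
      rw [norm_pos_iff]
      rintro rfl
      simp at hc
    have hk0 : (0 : ℝ) ≤ k := by positivity
    set T : EuclideanSpace ℝ I →ₗ[ℝ] EuclideanSpace ℝ (Fin k) :=
      { toFun := fun z => ∑ i : I, z i • sketchRow u S i
        map_add' := fun z z' => by simp [add_smul, Finset.sum_add_distrib]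
        map_smul' := fun a z => by simp [Finset.smul_sum, smul_smul] } with hT
    have hTn : ∀ z, ‖T z‖ ^ 2 ≤ 243 * k * ‖z‖ ^ 2 := hup S hSU
    set e := ‖c‖⁻¹ • c with he
    have he1 : ‖e‖ = 1 := by rw [he, norm_smul, norm_inv, norm_norm, inv_mul_cancel₀ hc0.ne']
    have hTe : ‖T e‖ ≤ √(η * k) := by
      refine Real.le_sqrt_of_sq_le ?_
      rw [he, map_smul, norm_smul, norm_inv, norm_norm, mul_pow, inv_pow, ← div_eq_inv_mul,
        div_le_iff₀ (by positivity)]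
      exact hc.le
    have hnear : ∀ z ∈ Metric.ball e ρ, |‖z‖ - 1| < ρ := by
      intro z hz
      rw [mem_ball_iff_norm] at hz
      rw [← he1]
      exact (abs_norm_sub_norm_le z e).trans_lt hz
    refine ⟨e, fun z hz => ?_, fun z hz => ?_⟩
    · have := (abs_lt.mp (hnear z hz)).2
      simp only [mem_ball_zero_iff]
      norm_num [hρ] at this
      linarith
    · have hz1 := (abs_lt.mp (hnear z hz)).1
      have hz2 : 1 / 2 ≤ ‖z‖ := by norm_num [hρ] at hz1; linarith
      have hTze : ‖T (z - e)‖ ≤ √(η * k) := by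
        refine Real.le_sqrt_of_sq_le ((hTn _).trans ?_)
        rw [mem_ball_iff_norm] at hz
        have : ‖z - e‖ ^ 2 ≤ ρ ^ 2 := by gcongr
        have h2 : η = 243 * ρ ^ 2 := by norm_num [hη, hρ]
        rw [h2]
        nlinarith
      have hTz : ‖T z‖ ≤ 2 * √(η * k) := by
        have := norm_add_le (T (z - e)) (T e)
        rw [← map_add, sub_add_cancel] at this
        linarith
      refine ⟨by change 0 < ‖z‖; linarith, ?_⟩
      change ‖T z‖ ^ 2 ≤ 16 * η * k * ‖z‖ ^ 2
      have h5 : ‖T z‖ ^ 2 ≤ (2 * √(η * k)) ^ 2 := by gcongr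
      rw [mul_pow, Real.sq_sqrt (by positivity)] at h5
      have h6 : (1 / 2) ^ 2 ≤ ‖z‖ ^ 2 := by gcongr
      have h7 : 0 ≤ η * k := by positivity
      nlinarith

end

/-! ### Projection onto the complement of a column space -/

/-- The orthogonal projection onto the complement of the column space of `M`. -/
noncomputable def residualProj {n k : ℕ} (M : Matrix (Fin n) (Fin k) ℝ) :
    Matrix (Fin n) (Fin n) ℝ :=
  1 - orthonormalBasisMatrix M * (orthonormalBasisMatrix M).transpose

section

variable {n k : ℕ} (M : Matrix (Fin n) (Fin k) ℝ)

theorem orthonormalBasisMatrix_transpose_mul_self :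
    (orthonormalBasisMatrix M).transpose * orthonormalBasisMatrix M = 1 := by
  ext i j
  have h := orthonormal_iff_ite.mp (stdOrthonormalBasis ℝ (columnSpace M)).orthonormal j i
  rw [Submodule.coe_inner, PiLp.inner_apply] at h
  simp only [Matrix.mul_apply, Matrix.transpose_apply, orthonormalBasisMatrix, Matrix.of_apply,
    Matrix.one_apply, eq_comm (a := i)]
  rw [← h]
  simp

theorem exists_orthonormalBasisMatrix_eq_mul :
    ∃ Y : Matrix (Fin k) (Fin (Module.finrank ℝ (columnSpace M))) ℝ,
      orthonormalBasisMatrix M = M * Y := by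
  have h : ∀ j, ∃ c : Fin k → ℝ, ∑ b, c b • (WithLp.toLp 2 fun i => M i b) =
      (stdOrthonormalBasis ℝ (columnSpace M) j : EuclideanSpace ℝ (Fin n)) := fun j =>
    (Submodule.mem_span_range_iff_exists_fun ℝ).mp (stdOrthonormalBasis ℝ (columnSpace M) j).2
  choose c hc using h
  refine ⟨Matrix.of fun b j => c j b, ?_⟩
  ext i j
  rw [Matrix.mul_apply]
  simp only [orthonormalBasisMatrix, Matrix.of_apply, ← hc j,
    WithLp.ofLp_sum, Finset.sum_apply, PiLp.smul_apply, smul_eq_mul, mul_comm]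

theorem residualProj_transpose : (residualProj M).transpose = residualProj M := by
  simp [residualProj, Matrix.transpose_sub, Matrix.transpose_mul]

theorem residualProj_mul_self : residualProj M * residualProj M = residualProj M := by
  have h : orthonormalBasisMatrix M * (orthonormalBasisMatrix M).transpose *
      (orthonormalBasisMatrix M * (orthonormalBasisMatrix M).transpose) =
      orthonormalBasisMatrix M * (orthonormalBasisMatrix M).transpose := by
    rw [Matrix.mul_assoc, ← Matrix.mul_assoc (orthonormalBasisMatrix M).transpose,
      orthonormalBasisMatrix_transpose_mul_self, Matrix.one_mul]
  simp [residualProj, Matrix.sub_mul, Matrix.mul_sub, h]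

theorem residualProj_mul : residualProj M * M = 0 := by
  rw [residualProj, Matrix.sub_mul, Matrix.one_mul, sub_eq_zero, Matrix.mul_assoc]
  ext i b
  set m : columnSpace M := ⟨WithLp.toLp 2 fun i => M i b, Submodule.subset_span ⟨b, rfl⟩⟩ with hm
  have h := congrArg (fun v : columnSpace M => (v : EuclideanSpace ℝ (Fin n)) i)
    ((stdOrthonormalBasis ℝ (columnSpace M)).sum_repr' m)
  simp only [Submodule.coe_sum, Submodule.coe_smul, WithLp.ofLp_sum, Finset.sum_apply,
    PiLp.smul_apply, smul_eq_mul, Submodule.coe_inner, PiLp.inner_apply, RCLike.inner_apply,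
    conj_trivial] at h
  simp only [Matrix.mul_apply, orthonormalBasisMatrix, Matrix.of_apply, Matrix.transpose_apply]
  refine Eq.trans h.symm (Finset.sum_congr rfl fun j _ => ?_)
  rw [mul_comm]
  congr 1
  exact Finset.sum_congr rfl fun a _ => mul_comm _ _

/-- The projection is a limit of resolvents, which are continuous in `M`. -/
theorem tendsto_resolvent_residualProj (a b : Fin n) :
    Filter.Tendsto (fun j : ℕ =>
      ((1 + (j : ℝ) • (M * M.transpose))⁻¹ : Matrix (Fin n) (Fin n) ℝ) a b) Filter.atTop
      (nhds (residualProj M a b)) := by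
  set N := M * M.transpose with hN
  set P := residualProj M with hP
  have hNpsd : N.PosSemidef := by
    have := Matrix.posSemidef_self_mul_conjTranspose M
    rwa [Matrix.conjTranspose_eq_transpose_of_trivial] at this
  have hunit : ∀ j : ℕ, IsUnit (1 + (j : ℝ) • N) := fun j =>
    (Matrix.PosDef.one.add_posSemidef (hNpsd.smul (Nat.cast_nonneg j))).isUnit
  let R : ℕ → Matrix (Fin n) (Fin n) ℝ := fun j => (1 + (j : ℝ) • N)⁻¹
  have hRl : ∀ j : ℕ, R j * (1 + (j : ℝ) • N) = 1 := fun j =>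
    Matrix.nonsing_inv_mul _ ((Matrix.isUnit_iff_isUnit_det _).mp (hunit j))
  have hRr : ∀ j : ℕ, (1 + (j : ℝ) • N) * R j = 1 := fun j =>
    Matrix.mul_nonsing_inv _ ((Matrix.isUnit_iff_isUnit_det _).mp (hunit j))
  have hNP : N * P = 0 := by
    have : M.transpose * P = 0 := by
      rw [← Matrix.transpose_transpose (M.transpose * P), Matrix.transpose_mul,
        Matrix.transpose_transpose, hP, residualProj_transpose, residualProj_mul,
        Matrix.transpose_zero]
    rw [hN, Matrix.mul_assoc, this, Matrix.mul_zero]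
  have hRP : ∀ j : ℕ, R j * P = P := by
    intro j
    have h : (1 + (j : ℝ) • N) * P = P := by
      rw [Matrix.add_mul, Matrix.smul_mul, hNP, smul_zero, add_zero, Matrix.one_mul]
    calc R j * P = R j * ((1 + (j : ℝ) • N) * P) := by rw [h]
      _ = P := by rw [← Matrix.mul_assoc, hRl, Matrix.one_mul]
  obtain ⟨Y, hY⟩ := exists_orthonormalBasisMatrix_eq_mul M
  have hsplit : ∀ j : ℕ, R j = P + R j * M * (Y * (orthonormalBasisMatrix M).transpose) := by
    intro j
    have h1 : (1 : Matrix (Fin n) (Fin n) ℝ) =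
        P + M * (Y * (orthonormalBasisMatrix M).transpose) := by
      rw [← Matrix.mul_assoc, ← hY, hP, residualProj, sub_add_cancel]
    calc R j = R j * 1 := (Matrix.mul_one _).symm
      _ = _ := by rw [h1, Matrix.mul_add, hRP, ← Matrix.mul_assoc]
  -- Each column `v` of `R j * M` solves `v + j N v = M e_b`; testing with `v` bounds its norm.
  have hsmall : ∀ (j : ℕ) (a : Fin n) (b : Fin k), 1 ≤ j → ((R j * M) a b) ^ 2 ≤ 1 / j := by
    intro j a b hj
    set v : Fin n → ℝ := fun a => (R j * M) a b with hv
    set w : Fin k → ℝ := Matrix.mulVec M.transpose v with hw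
    have hj0 : (0 : ℝ) < j := by exact_mod_cast hj
    have heq : v + (j : ℝ) • Matrix.mulVec M w = fun a => M a b := by
      have h1 : (1 + (j : ℝ) • N) * (R j * M) = M := by
        rw [← Matrix.mul_assoc, hRr, Matrix.one_mul]
      have h2 : Matrix.mulVec (1 + (j : ℝ) • N) v = fun a => M a b := by
        ext i
        exact congrFun (congrFun h1 i) b
      rw [← h2, Matrix.add_mulVec, Matrix.one_mulVec, Matrix.smul_mulVec, hN, hw,
        Matrix.mulVec_mulVec]
    have h3 : v ⬝ᵥ v + j * (w ⬝ᵥ w) = w b := by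
      have h4 := congrArg (fun x => v ⬝ᵥ x) heq
      simp only [dotProduct_add, dotProduct_smul, smul_eq_mul] at h4
      have h5 : v ⬝ᵥ Matrix.mulVec M w = w ⬝ᵥ w := by
        rw [Matrix.dotProduct_mulVec, hw, Matrix.mulVec_transpose]
      have h6 : (v ⬝ᵥ fun a => M a b) = w b := by
        rw [hw, Matrix.mulVec, dotProduct_comm]; rfl
      rw [← h6, ← h4, h5]
    have h7 : w b ^ 2 ≤ w ⬝ᵥ w := by
      have := Finset.single_le_sum (f := fun i => w i * w i)
        (fun i _ => mul_self_nonneg _) (Finset.mem_univ b)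
      simpa [dotProduct, pow_two] using this
    have h8 : v a ^ 2 ≤ v ⬝ᵥ v := by
      have := Finset.single_le_sum (f := fun i => v i * v i)
        (fun i _ => mul_self_nonneg _) (Finset.mem_univ a)
      simpa [dotProduct, pow_two] using this
    change v a ^ 2 ≤ 1 / j
    rw [le_div_iff₀ hj0]
    have h9 : v a ^ 2 ≤ w b - j * w b ^ 2 := by
      linarith [mul_le_mul_of_nonneg_left h7 hj0.le]
    nlinarith [sq_nonneg (j * w b - 1 / 2), mul_le_mul_of_nonneg_right h9 hj0.le]
  have hzero : ∀ (a : Fin n) (b : Fin k),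
      Filter.Tendsto (fun j => (R j * M) a b) Filter.atTop (nhds 0) := by
    intro a b
    have h1 : Filter.Tendsto (fun j : ℕ => ((R j * M) a b) ^ 2) Filter.atTop (nhds 0) :=
      squeeze_zero' (Filter.Eventually.of_forall fun j => sq_nonneg _)
        (Filter.eventually_atTop.mpr ⟨1, fun j hj => hsmall j a b hj⟩)
        tendsto_one_div_atTop_nhds_zero_nat
    have h2 := h1.sqrt
    simp only [Real.sqrt_sq_eq_abs, Real.sqrt_zero] at h2
    exact (tendsto_zero_iff_abs_tendsto_zero _).mpr h2
  have hfin : Filter.Tendsto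
      (fun j => P a b + ∑ c, (R j * M) a c * (Y * (orthonormalBasisMatrix M).transpose) c b)
      Filter.atTop (nhds (P a b + ∑ c, 0 * (Y * (orthonormalBasisMatrix M).transpose) c b)) :=
    tendsto_const_nhds.add (tendsto_finsetSum _ fun c _ => (hzero a c).mul_const _)
  simp only [zero_mul, Finset.sum_const_zero, add_zero] at hfin
  refine hfin.congr fun j => ?_
  change _ = R j a b
  rw [hsplit j, Matrix.add_apply, Matrix.mul_apply (M := R j * M), ← hsplit j]

theorem measurable_residualProj (B : Matrix (Fin n) (Fin n) ℝ) (a b : Fin n) :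
    Measurable fun S : Fin n → Fin k → ℝ => residualProj (B * Matrix.of S) a b := by
  refine measurable_of_tendsto_metrizable (f := fun (j : ℕ) (S : Fin n → Fin k → ℝ) =>
    ((1 + (j : ℝ) • (B * Matrix.of S * (B * Matrix.of S).transpose))⁻¹ :
      Matrix (Fin n) (Fin n) ℝ) a b) (fun j => ?_)
    (tendsto_pi_nhds.mpr fun S => tendsto_resolvent_residualProj _ a b)
  have hc : Continuous fun S : Fin n → Fin k → ℝ =>
      1 + (j : ℝ) • (B * Matrix.of S * (B * Matrix.of S).transpose) := by
    have h : Continuous fun S : Fin n → Fin k → ℝ => B * Matrix.of S :=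
      Continuous.matrix_mul continuous_const continuous_id
    have h2 := (h.matrix_mul h.matrix_transpose).const_smul (j : ℝ)
    exact continuous_const.add h2
  simp only [Matrix.inv_def, Matrix.smul_apply, smul_eq_mul, Ring.inverse_eq_inv']
  exact hc.matrix_det.measurable.inv.mul
    (((continuous_apply b).comp ((continuous_apply a).comp hc.matrix_adjugate)).measurable)

theorem hutchpp_eq (B F : Matrix (Fin n) (Fin n) ℝ) (s : ℕ) (S : Matrix (Fin n) (Fin (s / 4)) ℝ)
    (G : Matrix (Fin n) (Fin (s / 2)) ℝ) :
    hutchpp B F s S G = F.trace - (residualProj (B * S) * F * residualProj (B * S)).trace +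
      2 / (s : ℝ) *
        (G.transpose * (residualProj (B * S) * F * residualProj (B * S)) * G).trace := by
  set Q := orthonormalBasisMatrix (B * S)
  have h : (residualProj (B * S) * F * residualProj (B * S)).trace =
      F.trace - (Q.transpose * F * Q).trace := by
    rw [Matrix.mul_assoc, Matrix.trace_mul_comm, Matrix.mul_assoc, residualProj_mul_self,
      residualProj, Matrix.mul_sub, Matrix.mul_one, Matrix.trace_sub, ← Matrix.mul_assoc,
      Matrix.trace_mul_comm, ← Matrix.mul_assoc]
  rw [h, sub_sub_cancel]
  simp only [hutchpp, residualProj, Matrix.mul_assoc, Q]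

end

/-! ### Matrices diagonal in a fixed orthonormal basis -/

/-- The matrix `∑ i, f i • u_i u_iᵀ` with eigenvectors `u_i` and eigenvalues `f i`. -/
noncomputable def spectralMatrix {n : ℕ}
    (u : OrthonormalBasis (Fin n) ℝ (EuclideanSpace ℝ (Fin n))) (f : Fin n → ℝ) :
    Matrix (Fin n) (Fin n) ℝ :=
  Matrix.of fun a b => ∑ i, f i * (u i a * u i b)

section

variable {n k : ℕ} (u : OrthonormalBasis (Fin n) ℝ (EuclideanSpace ℝ (Fin n)))

theorem orthonormalBasis_dotProduct (i j : Fin n) :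
    ∑ a, u i a * u j a = if i = j then 1 else 0 := by
  rw [← orthonormal_iff_ite.mp u.orthonormal i j, PiLp.inner_apply]
  simp [mul_comm]

theorem orthonormalBasis_sum_mul (a b : Fin n) :
    ∑ i, u i a * u i b = if a = b then 1 else 0 := by
  have h := u.sum_inner_mul_inner (EuclideanSpace.single a 1) (EuclideanSpace.single b 1)
  simpa [EuclideanSpace.inner_single_left, EuclideanSpace.inner_single_right, eq_comm,
    Pi.single_apply] using h

theorem sum_orthonormalBasis_dotProduct_sq (y : Fin n → ℝ) :
    ∑ i, (u i ⬝ᵥ y) ^ 2 = y ⬝ᵥ y := by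
  have h := u.sum_sq_norm_inner_right (WithLp.toLp 2 y)
  rw [EuclideanSpace.real_norm_sq_eq] at h
  simp only [Real.norm_eq_abs, sq_abs, PiLp.inner_apply, RCLike.inner_apply, conj_trivial] at h
  simp only [dotProduct, ← pow_two]
  rw [← h]
  exact Finset.sum_congr rfl fun i _ => by
    congr 1
    exact Finset.sum_congr rfl fun a _ => mul_comm _ _

theorem eq_spectralMatrix {F : Matrix (Fin n) (Fin n) ℝ} {f : Fin n → ℝ}
    (h : ∀ i, F.mulVec (u i) = f i • (u i).ofLp) : F = spectralMatrix u f := by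
  ext a b
  have h1 : F a b = ∑ i, F.mulVec (u i) a * u i b := by
    simp only [Matrix.mulVec, dotProduct, Finset.sum_mul, mul_assoc]
    rw [Finset.sum_comm]
    simp only [← Finset.mul_sum, orthonormalBasis_sum_mul]
    simp
  rw [h1]
  simp [h, spectralMatrix, mul_assoc]

theorem spectralMatrix_eq_sum (f : Fin n → ℝ) :
    spectralMatrix u f = ∑ i, f i • Matrix.vecMulVec (u i).ofLp (u i).ofLp := by
  ext a b
  simp [spectralMatrix, Matrix.sum_apply, Matrix.vecMulVec_apply]

theorem dotProduct_spectralMatrix_mulVec (f : Fin n → ℝ) (x y : Fin n → ℝ) :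
    x ⬝ᵥ (spectralMatrix u f).mulVec y = ∑ i, f i * ((u i ⬝ᵥ x) * (u i ⬝ᵥ y)) := by
  rw [spectralMatrix_eq_sum, Matrix.sum_mulVec, dotProduct_sum]
  refine Finset.sum_congr rfl fun i _ => ?_
  rw [Matrix.smul_mulVec, dotProduct_smul, Matrix.vecMulVec_mulVec, smul_eq_mul,
    dotProduct_comm (u i).ofLp x]
  simp [dotProduct_smul, mul_comm]

theorem spectralMatrix_transpose (f : Fin n → ℝ) :
    (spectralMatrix u f).transpose = spectralMatrix u f := by
  ext a b
  simp [spectralMatrix, mul_comm]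

theorem trace_spectralMatrix_mul (f : Fin n → ℝ) (N : Matrix (Fin n) (Fin n) ℝ) :
    (spectralMatrix u f * N).trace = ∑ i, f i * (u i ⬝ᵥ N.mulVec (u i)) := by
  rw [spectralMatrix_eq_sum, Finset.sum_mul, Matrix.trace_sum]
  refine Finset.sum_congr rfl fun i _ => ?_
  rw [Matrix.smul_mul, Matrix.trace_smul, Matrix.vecMulVec_mul, Matrix.trace_vecMulVec,
    smul_eq_mul, Matrix.dotProduct_mulVec, dotProduct_comm]

theorem trace_spectralMatrix (f : Fin n → ℝ) : (spectralMatrix u f).trace = ∑ i, f i := by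
  rw [← Matrix.mul_one (spectralMatrix u f), trace_spectralMatrix_mul]
  refine Finset.sum_congr rfl fun i _ => ?_
  rw [Matrix.one_mulVec, dotProduct, orthonormalBasis_dotProduct]
  simp

/-- A vector annihilated by `(B S)ᵀ` gives a linear relation between the sketch rows. -/
theorem sum_smul_sketchRow_eq_zero {b : Fin n → ℝ} {S : Fin n → Fin k → ℝ} {y : Fin n → ℝ}
    (hy : Matrix.vecMul y (spectralMatrix u b * Matrix.of S) = 0) :
    ∑ i, (b i * (u i ⬝ᵥ y)) • sketchRow u S i = 0 := by
  ext c
  have h := congrFun hy c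
  rw [← Matrix.vecMul_vecMul] at h
  have h2 : Matrix.vecMul (Matrix.vecMul y (spectralMatrix u b)) (Matrix.of S) c =
      y ⬝ᵥ (spectralMatrix u b).mulVec fun a => S a c := by
    rw [Matrix.dotProduct_mulVec]; rfl
  rw [h2, dotProduct_spectralMatrix_mulVec] at h
  simp only [WithLp.ofLp_sum, Finset.sum_apply, PiLp.smul_apply, smul_eq_mul, sketchRow]
  simp only [Pi.zero_apply, dotProduct] at h
  simp only [dotProduct]
  rw [PiLp.zero_apply, ← h]
  exact Finset.sum_congr rfl fun i _ => by ring

end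

/-! ### The error of Hutch++ -/

/-- Hypotheses under which the range finder works: in the basis `u`, the matrix `B` whose range
is sampled has eigenvalues `b` and the matrix `F` whose trace is estimated has eigenvalues `f`.
The set `I` of leading eigenvectors has at most `k / 2` elements, the eigenvalues of `F`
off `I` sum to at most `T` and are at most `T / k`, and `b`, rescaled by `β`, is at most of
order one off `I` but dominates `f` on `I`. -/
structure IsSketchable {n : ℕ} (k : ℕ) (b f : Fin n → ℝ) (I : Finset (Fin n)) (β T : ℝ) :
    Prop where
  card_le : 2 * I.card ≤ k
  nonneg : ∀ i, 0 ≤ f i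
  le_on : ∀ i ∈ I, f i ≤ T / k * (β * b i) ^ 2
  le_off : ∀ i ∉ I, f i ≤ T / k
  sum_le : ∑ i ∈ Iᶜ, f i ≤ T
  sq_le_off : ∀ i ∉ I, (β * b i) ^ 2 ≤ 1
  sum_sq_le : ∑ i ∈ Iᶜ, (β * b i) ^ 2 ≤ k

namespace IsSketchable

variable {n k : ℕ} {u : OrthonormalBasis (Fin n) ℝ (EuclideanSpace ℝ (Fin n))}
  {b f : Fin n → ℝ} {I : Finset (Fin n)} {β T η : ℝ} {S : Fin n → Fin k → ℝ}

/-- On the complement of the sampled range, the quadratic form of `F` is of order `T / k`. -/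
theorem dotProduct_mulVec_le (h : IsSketchable k b f I β T) (hk : 0 < k) (hT : 0 ≤ T)
    (hη : 0 < η)
    (hlow : ∀ c : EuclideanSpace ℝ I,
      η * k * ‖c‖ ^ 2 ≤ ‖∑ i : I, c i • sketchRow u S i‖ ^ 2)
    (hup : ∀ w : EuclideanSpace ℝ (Fin k),
      ∑ i, (if i ∈ I then 0 else β * b i) ^ 2 * inner ℝ (sketchRow u S i) w ^ 2 ≤
        243 * k * ‖w‖ ^ 2)
    {y : Fin n → ℝ} (hy : Matrix.vecMul y (spectralMatrix u b * Matrix.of S) = 0) :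
    y ⬝ᵥ (spectralMatrix u f).mulVec y ≤ (243 / η + 1) * (T / k) * (y ⬝ᵥ y) := by
  have hk0 : (0 : ℝ) < k := by exact_mod_cast hk
  set c : EuclideanSpace ℝ I := WithLp.toLp 2 fun i => β * b i * (u i ⬝ᵥ y) with hc
  have hrel := sum_smul_sketchRow_eq_zero u hy
  have hrel2 : ∑ i : I, c i • sketchRow u S i = -∑ i, ((u i ⬝ᵥ y) *
      (if i ∈ I then 0 else β * b i)) • sketchRow u S i := by
    rw [eq_neg_iff_add_eq_zero]
    have h1 : ∑ i : I, c i • sketchRow u S i =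
        ∑ i, (if i ∈ I then β * b i * (u i ⬝ᵥ y) else 0) • sketchRow u S i := by
      simp only [ite_smul, zero_smul, Finset.sum_ite_mem, Finset.univ_inter]
      exact Finset.sum_coe_sort I fun i => (β * b i * (u i ⬝ᵥ y)) • sketchRow u S i
    rw [h1, ← Finset.sum_add_distrib]
    calc _ = ∑ i, β • ((b i * (u i ⬝ᵥ y)) • sketchRow u S i) := by
          refine Finset.sum_congr rfl fun i _ => ?_
          rw [← add_smul, smul_smul]
          congr 1
          split_ifs <;> ring
      _ = 0 := by rw [← Finset.smul_sum, hrel, smul_zero]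
  have hy0 : 0 ≤ y ⬝ᵥ y := by
    rw [← sum_orthonormalBasis_dotProduct_sq u]; positivity
  have h1 : η * k * ‖c‖ ^ 2 ≤ 243 * k * (y ⬝ᵥ y) := by
    refine (hlow c).trans ?_
    rw [hrel2, norm_neg, ← sum_orthonormalBasis_dotProduct_sq u]
    exact norm_sum_smul_sq_le (by positivity) hup _
  have h2 : ‖c‖ ^ 2 ≤ 243 / η * (y ⬝ᵥ y) := by
    rw [div_mul_eq_mul_div, le_div_iff₀ hη]
    have : k * (η * ‖c‖ ^ 2) ≤ k * (243 * (y ⬝ᵥ y)) := by linarith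
    have := le_of_mul_le_mul_left this hk0
    linarith
  have hc2 : ‖c‖ ^ 2 = ∑ i ∈ I, (β * b i) ^ 2 * (u i ⬝ᵥ y) ^ 2 := by
    rw [EuclideanSpace.real_norm_sq_eq]
    simp only [hc, mul_pow (β * b _)]
    exact Finset.sum_coe_sort I fun i => (β * b i) ^ 2 * (u i ⬝ᵥ y) ^ 2
  rw [dotProduct_spectralMatrix_mulVec, ← Finset.sum_add_sum_compl I]
  have h3 : ∑ i ∈ I, f i * ((u i ⬝ᵥ y) * (u i ⬝ᵥ y)) ≤ T / k * ‖c‖ ^ 2 := by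
    rw [hc2, Finset.mul_sum]
    refine Finset.sum_le_sum fun i hi => ?_
    rw [← pow_two, ← mul_assoc]
    exact mul_le_mul_of_nonneg_right (h.le_on i hi) (sq_nonneg _)
  have h4 : ∑ i ∈ Iᶜ, f i * ((u i ⬝ᵥ y) * (u i ⬝ᵥ y)) ≤ T / k * (y ⬝ᵥ y) := by
    calc _ ≤ ∑ i ∈ Iᶜ, T / k * (u i ⬝ᵥ y) ^ 2 := by
          refine Finset.sum_le_sum fun i hi => ?_
          rw [← pow_two]
          exact mul_le_mul_of_nonneg_right (h.le_off i (Finset.mem_compl.mp hi)) (sq_nonneg _)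
      _ ≤ ∑ i, T / k * (u i ⬝ᵥ y) ^ 2 := Finset.sum_le_univ_sum_of_nonneg fun i => by positivity
      _ = _ := by rw [← Finset.mul_sum, sum_orthonormalBasis_dotProduct_sq]
  have h5 : T / k * ‖c‖ ^ 2 ≤ T / k * (243 / η * (y ⬝ᵥ y)) := by gcongr
  linarith

/-- The part of `F` left over by the range finder has norm of order `T / k` and trace of order
`T`. For the trace over `I`, the bound on the norm is tested with the projections of the `u_i`. -/
theorem residual_bounds (h : IsSketchable k b f I β T) (hk : 0 < k) (hT : 0 ≤ T)
    (hη : 0 < η)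
    (hlow : ∀ c : EuclideanSpace ℝ I,
      η * k * ‖c‖ ^ 2 ≤ ‖∑ i : I, c i • sketchRow u S i‖ ^ 2)
    (hup : ∀ w : EuclideanSpace ℝ (Fin k),
      ∑ i, (if i ∈ I then 0 else β * b i) ^ 2 * inner ℝ (sketchRow u S i) w ^ 2 ≤
        243 * k * ‖w‖ ^ 2)
    {P : Matrix (Fin n) (Fin n) ℝ} (hP : P = residualProj (spectralMatrix u b * Matrix.of S)) :
    (∀ x, 0 ≤ x ⬝ᵥ (P * spectralMatrix u f * P).mulVec x) ∧
    (∀ x, x ⬝ᵥ (P * spectralMatrix u f * P).mulVec x ≤ (243 / η + 1) * (T / k) * (x ⬝ᵥ x)) ∧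
    (P * spectralMatrix u f * P).trace ≤ (243 / η + 2) * T := by
  have hk0 : (0 : ℝ) < k := by exact_mod_cast hk
  have hPt : P.transpose = P := by rw [hP, residualProj_transpose]
  have hPP : P * P = P := by rw [hP, residualProj_mul_self]
  set C := 243 / η + 1 with hC
  have hC0 : 0 < C := by positivity
  have hquad : ∀ x, x ⬝ᵥ (P * spectralMatrix u f * P).mulVec x =
      P.mulVec x ⬝ᵥ (spectralMatrix u f).mulVec (P.mulVec x) := by
    intro x
    rw [← Matrix.mulVec_mulVec, ← Matrix.mulVec_mulVec, Matrix.dotProduct_mulVec,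
      ← Matrix.mulVec_transpose, hPt]
  have hnn : ∀ y, 0 ≤ y ⬝ᵥ (spectralMatrix u f).mulVec y := by
    intro y
    rw [dotProduct_spectralMatrix_mulVec]
    exact Finset.sum_nonneg fun i _ => mul_nonneg (h.nonneg i) (mul_self_nonneg _)
  have hPx : ∀ x, P.mulVec x ⬝ᵥ P.mulVec x = x ⬝ᵥ P.mulVec x := by
    intro x
    rw [Matrix.dotProduct_mulVec, ← Matrix.mulVec_transpose, hPt, Matrix.mulVec_mulVec, hPP,
      dotProduct_comm]
  have hPle : ∀ x, P.mulVec x ⬝ᵥ P.mulVec x ≤ x ⬝ᵥ x := by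
    intro x
    have h1 : 0 ≤ (x - P.mulVec x) ⬝ᵥ (x - P.mulVec x) :=
      Finset.sum_nonneg fun i _ => mul_self_nonneg _
    rw [sub_dotProduct, dotProduct_sub, dotProduct_sub, hPx, dotProduct_comm (P.mulVec x) x] at h1
    rw [hPx]
    linarith
  have hmain : ∀ x, P.mulVec x ⬝ᵥ (spectralMatrix u f).mulVec (P.mulVec x) ≤
      C * (T / k) * (P.mulVec x ⬝ᵥ P.mulVec x) := by
    intro x
    refine h.dotProduct_mulVec_le hk hT hη hlow hup ?_
    rw [← hPt, Matrix.mulVec_transpose, Matrix.vecMul_vecMul, hP, residualProj_mul,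
      Matrix.vecMul_zero]
  refine ⟨fun x => by rw [hquad]; exact hnn _, fun x => ?_, ?_⟩
  · rw [hquad]
    exact (hmain x).trans (mul_le_mul_of_nonneg_left (hPle x) (by positivity))
  · rw [Matrix.mul_assoc, Matrix.trace_mul_comm, Matrix.mul_assoc, hPP,
      trace_spectralMatrix_mul, ← Finset.sum_add_sum_compl I]
    have hoff : ∑ i ∈ Iᶜ, f i * (u i ⬝ᵥ P.mulVec (u i)) ≤ T := by
      refine le_trans (Finset.sum_le_sum fun i _ => ?_) h.sum_le
      have h1 := hPle (u i)
      rw [hPx, dotProduct, dotProduct, orthonormalBasis_dotProduct, if_pos rfl] at h1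
      exact mul_le_of_le_one_right (h.nonneg i) h1
    have hon : ∀ i ∈ I, f i * (u i ⬝ᵥ P.mulVec (u i)) ≤ C * (T / k) := by
      intro i _
      have h1 := hmain (u i)
      rw [hPx] at h1
      set t := u i ⬝ᵥ P.mulVec (u i) with ht
      have ht0 : 0 ≤ t := by
        rw [ht, ← hPx]; exact Finset.sum_nonneg fun i _ => mul_self_nonneg _
      have h2 : f i * (t * t) ≤
          P.mulVec (u i) ⬝ᵥ (spectralMatrix u f).mulVec (P.mulVec (u i)) := by
        rw [dotProduct_spectralMatrix_mulVec]
        exact Finset.single_le_sum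
          (f := fun j => f j * ((u j ⬝ᵥ P.mulVec (u i)) * (u j ⬝ᵥ P.mulVec (u i))))
          (fun j _ => mul_nonneg (h.nonneg j) (mul_self_nonneg _)) (Finset.mem_univ i)
      rcases ht0.eq_or_lt with h0 | h0
      · rw [← h0, mul_zero]; positivity
      · have h3 : f i * t * t ≤ C * (T / k) * t := by linarith
        exact le_of_mul_le_mul_right h3 h0
    have hsum : ∑ i ∈ I, f i * (u i ⬝ᵥ P.mulVec (u i)) ≤ C * T := by
      refine (Finset.sum_le_card_nsmul I _ _ hon).trans ?_
      rw [nsmul_eq_mul]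
      have hcard : (I.card : ℝ) ≤ k := by
        have := h.card_le
        exact_mod_cast (by omega : I.card ≤ k)
      calc (I.card : ℝ) * (C * (T / k)) ≤ k * (C * (T / k)) := by gcongr
        _ = C * T := by field_simp
    calc _ ≤ C * T + T := add_le_add hsum hoff
      _ = _ := by rw [hC]; ring

end IsSketchable

section

variable {n : ℕ} (v : OrthonormalBasis (Fin n) ℝ (EuclideanSpace ℝ (Fin n)))

/-- The moment generating function of the centred Hutchinson estimator of a matrix with
eigenvectors `v i` and eigenvalues `μ i`, a weighted sum of independent centred `χ²` variables. -/
theorem lintegral_exp_hutchinson_le (l : ℕ) {μ : Fin n → ℝ} (hμ : ∀ i, |μ i| ≤ 1 / 4) :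
    ∫⁻ G, ENNReal.ofReal (Real.exp (∑ c, ∑ i, μ i * ((∑ a, v i a * G a c) ^ 2 - 1)))
      ∂(gaussianMatrix n l) ≤ ENNReal.ofReal (Real.exp (4 * l * ∑ i, μ i ^ 2)) := by
  rw [← gaussianMatrix_map_transpose l n, lintegral_map (by fun_prop) (by fun_prop)]
  have hprod : ∀ G : Fin l → Fin n → ℝ,
      ENNReal.ofReal (Real.exp (∑ c, ∑ i, μ i * ((∑ a, v i a * G c a) ^ 2 - 1))) =
      ∏ c, ENNReal.ofReal (Real.exp (∑ i, μ i * ((∑ a, v i a * G c a) ^ 2 - 1))) := by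
    intro G
    rw [← ENNReal.ofReal_prod_of_nonneg (fun i _ => Real.exp_nonneg _), ← Real.exp_sum]
  simp_rw [hprod]
  have hone : ∫⁻ x, ENNReal.ofReal (Real.exp (∑ i, μ i * ((∑ a, v i a * x a) ^ 2 - 1)))
      ∂(gaussianVector (Fin n)) ≤ ENNReal.ofReal (Real.exp (4 * ∑ i, μ i ^ 2)) := by
    have hmap := lintegral_map (μ := gaussianVector (Fin n))
      (f := fun y : Fin n → ℝ => ENNReal.ofReal (Real.exp (∑ i, μ i * (y i ^ 2 - 1))))
      (g := fun x i => ∑ a, v i a * x a) (by fun_prop) (by fun_prop)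
    rw [gaussianVector_map_orthonormalBasis v] at hmap
    rw [← hmap]
    have hprod2 : ∀ y : Fin n → ℝ, ENNReal.ofReal (Real.exp (∑ i, μ i * (y i ^ 2 - 1))) =
        ∏ i, ENNReal.ofReal (Real.exp (μ i * (y i ^ 2 - 1))) := by
      intro y
      rw [← ENNReal.ofReal_prod_of_nonneg (fun i _ => Real.exp_nonneg _), ← Real.exp_sum]
    simp_rw [hprod2]
    rw [lintegral_pi_prod _ (fun i t => ENNReal.ofReal (Real.exp (μ i * (t ^ 2 - 1))))
      (fun i => by fun_prop), Finset.mul_sum, Real.exp_sum,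
      ENNReal.ofReal_prod_of_nonneg (fun i _ => Real.exp_nonneg _)]
    exact Finset.prod_le_prod' fun i _ => lintegral_exp_sq_sub_one_le (hμ i)
  have hpi := lintegral_pi_prod (ι := Fin l) (gaussianVector (Fin n))
    (fun _ x => ENNReal.ofReal (Real.exp (∑ i, μ i * ((∑ a, v i a * x a) ^ 2 - 1))))
    (fun _ => by fun_prop)
  refine hpi.trans_le ?_
  rw [Finset.prod_const, Finset.card_univ, Fintype.card_fin]
  refine (pow_le_pow_left' hone l).trans_eq ?_
  rw [← ENNReal.ofReal_pow (Real.exp_nonneg _), ← Real.exp_nat_mul]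
  congr 2; ring

theorem trace_transpose_mul_spectralMatrix_mul {l : ℕ} (μ : Fin n → ℝ) (G : Fin n → Fin l → ℝ) :
    ((Matrix.of G).transpose * spectralMatrix v μ * Matrix.of G).trace =
      ∑ c, ∑ i, μ i * (∑ a, v i a * G a c) ^ 2 := by
  rw [Matrix.trace]
  refine Finset.sum_congr rfl fun c _ => ?_
  have h : ((Matrix.of G).transpose * spectralMatrix v μ * Matrix.of G).diag c =
      (fun a => G a c) ⬝ᵥ (spectralMatrix v μ).mulVec fun a => G a c := by
    rw [Matrix.diag, Matrix.mul_assoc]; rfl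
  rw [h, dotProduct_spectralMatrix_mulVec]
  exact Finset.sum_congr rfl fun i _ => by rw [← pow_two]; rfl

/-- Hutchinson's estimator with `l` Gaussian vectors, for a positive semidefinite matrix with
norm at most `K / k` and trace at most `K`. -/
theorem gaussianMatrix_hutchinson_le {k l : ℕ} (hk : 0 < k) {μ : Fin n → ℝ} {K t : ℝ} (hK : 0 < K)
    (h0 : ∀ i, 0 ≤ μ i) (h1 : ∀ i, μ i ≤ K / k) (hs : ∑ i, μ i ≤ K) (ht0 : 0 ≤ t) (ht1 : t ≤ 1) :
    gaussianMatrix n l {G | t * K * l <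
      |((Matrix.of G).transpose * spectralMatrix v μ * Matrix.of G).trace - l * ∑ i, μ i|} ≤
      ENNReal.ofReal (2 * Real.exp (-(t ^ 2 * k * l / 16))) := by
  have hk0 : (0 : ℝ) < k := by exact_mod_cast hk
  have hdev : ∀ G : Fin n → Fin l → ℝ,
      ((Matrix.of G).transpose * spectralMatrix v μ * Matrix.of G).trace - l * ∑ i, μ i =
      ∑ c, ∑ i, μ i * ((∑ a, v i a * G a c) ^ 2 - 1) := by
    intro G
    rw [trace_transpose_mul_spectralMatrix_mul]
    simp [mul_sub, Finset.sum_sub_distrib]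
  have hsq : ∑ i, μ i ^ 2 ≤ K ^ 2 / k := by
    calc ∑ i, μ i ^ 2 ≤ ∑ i, K / k * μ i := Finset.sum_le_sum fun i _ => by
          rw [pow_two]; exact mul_le_mul_of_nonneg_right (h1 i) (h0 i)
      _ = K / k * ∑ i, μ i := by rw [Finset.mul_sum]
      _ ≤ K / k * K := by gcongr
      _ = _ := by ring
  -- The exponent `t k / (8 K)` optimizes the Chernoff bound; `σ` is the sign of the deviation.
  have hside : ∀ σ : ℝ, |σ| = 1 →
      gaussianMatrix n l {G | t * K * l <
        σ * ∑ c, ∑ i, μ i * ((∑ a, v i a * G a c) ^ 2 - 1)} ≤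
      ENNReal.ofReal (Real.exp (-(t ^ 2 * k * l / 16))) := by
    intro σ hσ
    set θ : ℝ := t * k / (8 * K) with hθ
    have hθ0 : 0 ≤ θ := by positivity
    have hint := lintegral_exp_hutchinson_le v l (μ := fun i => σ * θ * μ i) (fun i => by
      rw [abs_mul, abs_mul, hσ, one_mul, abs_of_nonneg hθ0, abs_of_nonneg (h0 i)]
      calc θ * μ i ≤ θ * (K / k) := by gcongr; exact h1 i
        _ = t / 8 := by rw [hθ]; field_simp
        _ ≤ 1 / 4 := by linarith)
    have hint2 := hint.trans (ENNReal.ofReal_le_ofReal (Real.exp_le_exp.mpr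
      (show 4 * (l : ℝ) * ∑ i, (σ * θ * μ i) ^ 2 ≤ t ^ 2 * k * l / 16 by
        have hσ2 : σ ^ 2 = 1 := by rw [← sq_abs, hσ, one_pow]
        simp only [mul_pow, hσ2, one_mul]
        rw [← Finset.mul_sum]
        calc 4 * (l : ℝ) * (θ ^ 2 * ∑ i, μ i ^ 2) ≤ 4 * l * (θ ^ 2 * (K ^ 2 / k)) := by gcongr
          _ = _ := by rw [hθ]; field_simp; ring)))
    refine (measure_le_exp_of_lintegral_exp_le _ _ (by fun_prop) (a := t ^ 2 * k * l / 8)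
      (fun G hG => ?_) hint2).trans_eq ?_
    · have hG' : t * K * l < σ * ∑ c, ∑ i, μ i * ((∑ a, v i a * G a c) ^ 2 - 1) := hG
      have h2 := mul_le_mul_of_nonneg_left hG'.le hθ0
      have h3 : θ * (t * K * l) = t ^ 2 * k * l / 8 := by rw [hθ]; field_simp
      rw [h3] at h2
      refine h2.trans_eq ?_
      simp only [Finset.mul_sum]
      exact Finset.sum_congr rfl fun c _ => Finset.sum_congr rfl fun i _ => by ring
    · congr 2; ring
  calc _ ≤ gaussianMatrix n l ({G | t * K * l <
        1 * ∑ c, ∑ i, μ i * ((∑ a, v i a * G a c) ^ 2 - 1)} ∪ {G | t * K * l <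
        (-1) * ∑ c, ∑ i, μ i * ((∑ a, v i a * G a c) ^ 2 - 1)}) := by
        refine measure_mono fun G hG => ?_
        have hG' : t * K * l <
          |((Matrix.of G).transpose * spectralMatrix v μ * Matrix.of G).trace -
            l * ∑ i, μ i| := hG
        rw [hdev, lt_abs] at hG'
        rcases hG' with h | h
        · exact Or.inl (by simpa only [Set.mem_ofPred_eq, one_mul] using h)
        · exact Or.inr (by simpa only [Set.mem_ofPred_eq, neg_one_mul] using h)
    _ ≤ _ := measure_union_le _ _
    _ ≤ _ := add_le_add (hside 1 (by simp)) (hside (-1) (by simp))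
    _ = _ := by
        rw [← ENNReal.ofReal_add (Real.exp_nonneg _) (Real.exp_nonneg _)]; congr 1; ring

end

theorem exists_eq_spectralMatrix {n : ℕ} {N : Matrix (Fin n) (Fin n) ℝ} (hN : N.IsHermitian)
    {K : ℝ} (h0 : ∀ x, 0 ≤ x ⬝ᵥ N.mulVec x) (h1 : ∀ x, x ⬝ᵥ N.mulVec x ≤ K * (x ⬝ᵥ x)) :
    ∃ (v : OrthonormalBasis (Fin n) ℝ (EuclideanSpace ℝ (Fin n))) (μ : Fin n → ℝ),
      N = spectralMatrix v μ ∧ (∀ i, 0 ≤ μ i) ∧ ∀ i, μ i ≤ K := by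
  refine ⟨hN.eigenvectorBasis, hN.eigenvalues,
    eq_spectralMatrix _ fun i => hN.mulVec_eigenvectorBasis i, fun i => ?_, fun i => ?_⟩
  all_goals
    have hone : (hN.eigenvectorBasis i) ⬝ᵥ (hN.eigenvectorBasis i) = (1 : ℝ) := by
      rw [dotProduct, orthonormalBasis_dotProduct, if_pos rfl]
    have hq : (hN.eigenvectorBasis i) ⬝ᵥ N.mulVec (hN.eigenvectorBasis i) = hN.eigenvalues i := by
      rw [hN.mulVec_eigenvectorBasis, dotProduct_smul, hone]; simp
  · rw [← hq]; exact h0 _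
  · have := h1 (hN.eigenvectorBasis i)
    rwa [hq, hone, mul_one] at this

/-- The error of Hutch++ relative to the tail `T` of the spectrum. -/
theorem hutchpp_concentration : ∃ C : ℝ, 1 ≤ C ∧
    ∀ {n s : ℕ} (u : OrthonormalBasis (Fin n) ℝ (EuclideanSpace ℝ (Fin n)))
      {b f : Fin n → ℝ} {I : Finset (Fin n)} {β T t : ℝ}, 4 ∣ s → 0 < s → 0 < T →
      IsSketchable (s / 4) b f I β T → 0 ≤ t → t ≤ 1 →
    ((gaussianMatrix n (s / 4)).prod (gaussianMatrix n (s / 2)))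
      {p | t * (C * T) < |hutchpp (spectralMatrix u b) (spectralMatrix u f) s
        (Matrix.of p.1) (Matrix.of p.2) - ∑ i, f i|} ≤
      ENNReal.ofReal (3 * Real.exp (-(s / 4)) + 2 * Real.exp (-(t ^ 2 * s ^ 2 / 128))) := by
  obtain ⟨η, hη, hlow⟩ := gaussianMatrix_le_norm_sum_sq
  have hη3 : 0 < 243 / η := by positivity
  refine ⟨243 / η + 2, by linarith, ?_⟩
  intro n s u b f I β T t hs4 hs0 hT h ht0 ht1
  obtain ⟨k, rfl⟩ := hs4
  have hk4 : 4 * k / 4 = k := by omega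
  have hk2 : 4 * k / 2 = 2 * k := by omega
  have hk : 0 < k := by omega
  have hk0 : (0 : ℝ) < k := by exact_mod_cast hk
  set C := 243 / η + 2 with hC
  have hC0 : 0 < C := by positivity
  set d : Fin n → ℝ := fun i => if i ∈ I then 0 else β * b i with hd
  have hd1 : ∀ i, d i ^ 2 ≤ 1 := by
    intro i
    simp only [hd]
    split_ifs with hi
    · norm_num
    · exact h.sq_le_off i hi
  have hds : ∑ i, d i ^ 2 ≤ (4 * k / 4 : ℕ) := by
    refine le_trans (le_of_eq ?_) h.sum_sq_le
    rw [← Finset.sum_add_sum_compl I]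
    have h1 : ∑ i ∈ I, d i ^ 2 = 0 := Finset.sum_eq_zero fun i hi => by simp [hd, hi]
    rw [h1, zero_add]
    exact Finset.sum_congr rfl fun i hi => by simp [hd, Finset.mem_compl.mp hi]
  set U1 : Set (Fin n → Fin (4 * k / 4) → ℝ) := {S | ∃ c : EuclideanSpace ℝ I,
        ‖∑ i : I, c i • sketchRow u S i‖ ^ 2 < η * (4 * k / 4 : ℕ) * ‖c‖ ^ 2} with hU1
  set U2 : Set (Fin n → Fin (4 * k / 4) → ℝ) := {S | ∃ w : EuclideanSpace ℝ (Fin (4 * k / 4)),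
        243 * (4 * k / 4 : ℕ) * ‖w‖ ^ 2 < ∑ i, d i ^ 2 * inner ℝ (sketchRow u S i) w ^ 2} with hU2
  set μ := gaussianMatrix n (4 * k / 4) with hμ
  set ν := gaussianMatrix n (4 * k / 2) with hν
  have hU : μ (U1 ∪ U2) ≤ ENNReal.ofReal (3 * Real.exp (-k)) := by
    refine (measure_union_le _ _).trans ((add_le_add (hlow u I h.card_le)
      (gaussianMatrix_weighted_norm_le u (fun i => sq_nonneg (d i)) hd1 hds)).trans_eq ?_)
    rw [← ENNReal.ofReal_add (by positivity) (by positivity), hk4]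
    congr 1; ring
  set V := toMeasurable μ (U1 ∪ U2)
  have hVm : MeasurableSet V := measurableSet_toMeasurable _ _
  -- `N S` is the part of `F` left over by the range finder.
  set N : (Fin n → Fin (4 * k / 4) → ℝ) → Matrix (Fin n) (Fin n) ℝ := fun S =>
    residualProj (spectralMatrix u b * Matrix.of S) * spectralMatrix u f *
      residualProj (spectralMatrix u b * Matrix.of S) with hN
  have hNm : ∀ i j, Measurable fun S => N S i j := by
    intro i j
    have hP := measurable_residualProj (k := 4 * k / 4) (spectralMatrix u b)
    simp only [hN, Matrix.mul_apply]
    exact Finset.measurable_sum _ fun a _ => (Finset.measurable_sum _ fun c _ =>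
      (hP i c).mul_const _).mul (hP a j)
  set D : (Fin n → Fin (4 * k / 4) → ℝ) × (Fin n → Fin (4 * k / 2) → ℝ) → ℝ := fun p =>
    |((Matrix.of p.2).transpose * N p.1 * Matrix.of p.2).trace - (2 * k : ℕ) * (N p.1).trace|
    with hD
  have hDm : Measurable D := by
    refine Measurable.abs (Measurable.sub ?_ (Measurable.const_mul ?_ _))
    · simp only [Matrix.trace, Matrix.diag, Matrix.mul_apply, Matrix.transpose_apply,
        Matrix.of_apply]
      refine Finset.measurable_sum _ fun c _ => Finset.measurable_sum _ fun a _ =>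
        Measurable.mul (Finset.measurable_sum _ fun e _ => Measurable.mul (by fun_prop) ?_)
          (by fun_prop)
      exact (hNm e a).comp measurable_fst
    · exact Finset.measurable_sum _ fun a _ => (hNm a a).comp measurable_fst
  set H := {p | p.1 ∉ V ∧ t * (C * T) * (2 * k : ℕ) < D p} with hH
  have hHm : MeasurableSet H :=
    (hVm.compl.preimage measurable_fst).inter (measurableSet_lt measurable_const hDm)
  have hsec : ∀ S, ν (Prod.mk S ⁻¹' H) ≤ ENNReal.ofReal (2 * Real.exp (-(t ^ 2 * k * k / 8))) := by
    intro S
    by_cases hS : S ∈ V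
    · have : Prod.mk S ⁻¹' H = ∅ := by
        ext G
        simp [hH, hS]
      simp [this]
    · have hS2 : S ∉ U1 ∪ U2 := fun hc => hS (subset_toMeasurable _ _ hc)
      simp only [Set.mem_union, not_or] at hS2
      obtain ⟨hSl, hSu⟩ := hS2
      obtain ⟨hn0, hn1, hn2⟩ := h.residual_bounds (u := u) (by omega) hT.le hη (S := S)
        (fun c => not_lt.mp fun hc => hSl ⟨c, hc⟩) (fun w => not_lt.mp fun hc => hSu ⟨w, hc⟩) rfl
      have hNH : (N S).IsHermitian := by
        rw [Matrix.IsHermitian, Matrix.conjTranspose_eq_transpose_of_trivial]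
        simp only [hN, Matrix.transpose_mul, residualProj_transpose, spectralMatrix_transpose,
          Matrix.mul_assoc]
      obtain ⟨v, e, hNe, he0, he1⟩ := exists_eq_spectralMatrix hNH hn0 hn1
      have htr : (N S).trace = ∑ i, e i := by rw [hNe, trace_spectralMatrix]
      have hhut := gaussianMatrix_hutchinson_le v (l := 4 * k / 2) hk (μ := e) (K := C * T) (t := t)
        (by positivity) he0 (fun i => (he1 i).trans ?_) (by rw [← htr]; exact hn2) ht0 ht1
      · refine le_trans (measure_mono fun G hG => ?_) (hhut.trans_eq ?_)
        · have hG2 : t * (C * T) * (2 * k : ℕ) < D (S, G) := hG.2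
          simp only [hD, htr] at hG2
          rw [hNe] at hG2
          simpa only [hk2, Set.mem_ofPred_eq] using hG2
        · rw [hk2]; push_cast; congr 4; ring
      · rw [hk4, hC, mul_div_assoc]
        have : 0 ≤ T / k := by positivity
        nlinarith
  have hprob : (μ.prod ν) H ≤ ENNReal.ofReal (2 * Real.exp (-(t ^ 2 * k * k / 8))) := by
    rw [Measure.prod_apply hHm]
    refine (lintegral_mono hsec).trans_eq ?_
    rw [lintegral_const, measure_univ, mul_one]
  calc (μ.prod ν) {p | t * (C * T) < |hutchpp (spectralMatrix u b) (spectralMatrix u f) (4 * k)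
        (Matrix.of p.1) (Matrix.of p.2) - ∑ i, f i|}
      ≤ (μ.prod ν) (V ×ˢ Set.univ ∪ H) := by
        refine measure_mono fun p hp => ?_
        by_cases hpV : p.1 ∈ V
        · exact Or.inl ⟨hpV, trivial⟩
        · refine Or.inr ⟨hpV, ?_⟩
          have hp' : t * (C * T) < |hutchpp (spectralMatrix u b) (spectralMatrix u f) (4 * k)
            (Matrix.of p.1) (Matrix.of p.2) - ∑ i, f i| := hp
          rw [hutchpp_eq, trace_spectralMatrix] at hp'
          have heq : ∑ i, f i - (N p.1).trace + 2 / ((4 * k : ℕ) : ℝ) *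
              ((Matrix.of p.2).transpose * N p.1 * Matrix.of p.2).trace - ∑ i, f i =
              (((Matrix.of p.2).transpose * N p.1 * Matrix.of p.2).trace -
                (2 * k : ℕ) * (N p.1).trace) / (2 * k : ℕ) := by
            push_cast
            field_simp
            ring
          have hp2 : t * (C * T) < |(((Matrix.of p.2).transpose * N p.1 * Matrix.of p.2).trace -
                (2 * k : ℕ) * (N p.1).trace) / (2 * k : ℕ)| := by rw [← heq]; exact hp'
          rw [abs_div, Nat.abs_cast, lt_div_iff₀ (by push_cast; positivity)] at hp2
          exact hp2
    _ ≤ (μ.prod ν) (V ×ˢ Set.univ) + (μ.prod ν) H := measure_union_le _ _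
    _ ≤ ENNReal.ofReal (3 * Real.exp (-k)) +
          ENNReal.ofReal (2 * Real.exp (-(t ^ 2 * k * k / 8))) := by
        refine add_le_add ?_ hprob
        rw [Measure.prod_prod, measure_univ, mul_one, measure_toMeasurable]
        exact hU
    _ = _ := by
        rw [← ENNReal.ofReal_add (by positivity) (by positivity)]
        push_cast
        congr 5 <;> ring

/-! ### Chebyshev interpolation of powers -/

/-- The weight of the value at the node of index `i` in the Chebyshev interpolant at `x`. -/
noncomputable def chebyshevWeight (m i : ℕ) (x : ℝ) : ℝ :=
  2 / ((m : ℝ) + 1) * (1 / 2 + ∑ j ∈ Finset.Icc 1 m,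
    (Polynomial.Chebyshev.T ℝ (j : ℤ)).eval (chebyshevNode m i) *
      (Polynomial.Chebyshev.T ℝ (j : ℤ)).eval x)

/-- The error at `x` of the Chebyshev interpolant of `g`. -/
noncomputable def chebyshevError (m : ℕ) (x : ℝ) (g : ℝ → ℝ) : ℝ :=
  g x - ∑ i ∈ Finset.range (m + 1), g (chebyshevNode m i) * chebyshevWeight m i x

theorem abs_chebyshevNode_le_one (m i : ℕ) : |chebyshevNode m i| ≤ 1 := Real.abs_cos_le_one _

theorem sum_mul_chebyshevWeight (g : ℝ → ℝ) (m : ℕ) (x : ℝ) :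
    ∑ i ∈ Finset.range (m + 1), g (chebyshevNode m i) * chebyshevWeight m i x =
      chebyshevCoeff g m 0 / 2 + ∑ j ∈ Finset.Icc 1 m,
        chebyshevCoeff g m j * (Polynomial.Chebyshev.T ℝ (j : ℤ)).eval x := by
  simp only [chebyshevWeight, chebyshevCoeff, mul_add, Finset.sum_add_distrib, Finset.mul_sum,
    Finset.sum_mul]
  congr 1
  · rw [Finset.sum_div]
    refine Finset.sum_congr rfl fun i _ => ?_
    simp
    ring
  · rw [Finset.sum_comm]
    exact Finset.sum_congr rfl fun j _ => Finset.sum_congr rfl fun i _ => by ring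

theorem chebyshevError_eq (m : ℕ) (x : ℝ) (g : ℝ → ℝ) : chebyshevError m x g =
    g x - (chebyshevCoeff g m 0 / 2 + ∑ j ∈ Finset.Icc 1 m,
      chebyshevCoeff g m j * (Polynomial.Chebyshev.T ℝ (j : ℤ)).eval x) := by
  rw [chebyshevError, sum_mul_chebyshevWeight]

theorem abs_chebyshevCoeff_le {g : ℝ → ℝ} {m : ℕ} (hg : ∀ i, |g (chebyshevNode m i)| ≤ 1) (j : ℕ) :
    |chebyshevCoeff g m j| ≤ 2 := by
  have h : |∑ i ∈ Finset.range (m + 1), g (chebyshevNode m i) *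
      (Polynomial.Chebyshev.T ℝ (j : ℤ)).eval (chebyshevNode m i)| ≤ (m : ℝ) + 1 := by
    refine (Finset.abs_sum_le_sum_abs _ _).trans ?_
    calc _ ≤ ∑ _i ∈ Finset.range (m + 1), (1 : ℝ) := Finset.sum_le_sum fun i _ => by
          rw [abs_mul]
          exact mul_le_one₀ (hg i) (abs_nonneg _)
            (Polynomial.Chebyshev.abs_eval_T_real_le_one _ (abs_chebyshevNode_le_one m i))
      _ = (m : ℝ) + 1 := by simp
  rw [chebyshevCoeff, abs_mul, abs_of_pos (by positivity)]
  calc 2 / ((m : ℝ) + 1) * _ ≤ 2 / ((m : ℝ) + 1) * ((m : ℝ) + 1) := by gcongr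
    _ = 2 := by field_simp

theorem abs_chebyshevError_le {g : ℝ → ℝ} {m : ℕ} {x : ℝ} (hx : |x| ≤ 1)
    (hg : ∀ y, |y| ≤ 1 → |g y| ≤ 1) : |chebyshevError m x g| ≤ 2 * m + 2 := by
  have hc := abs_chebyshevCoeff_le (g := g) (m := m) fun i => hg _ (abs_chebyshevNode_le_one m i)
  rw [chebyshevError_eq]
  have h1 : |∑ j ∈ Finset.Icc 1 m,
      chebyshevCoeff g m j * (Polynomial.Chebyshev.T ℝ (j : ℤ)).eval x| ≤ 2 * m := by
    refine (Finset.abs_sum_le_sum_abs _ _).trans ?_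
    calc _ ≤ ∑ _j ∈ Finset.Icc 1 m, (2 : ℝ) := Finset.sum_le_sum fun j _ => by
          rw [abs_mul]
          have := Polynomial.Chebyshev.abs_eval_T_real_le_one (j : ℤ) hx
          nlinarith [hc j, abs_nonneg (chebyshevCoeff g m j)]
      _ = 2 * m := by simp [mul_comm]
  have h2 := hc 0
  have h3 := hg x hx
  rw [abs_le] at *
  constructor <;> linarith [h1.1, h1.2, h2.1, h2.2, h3.1, h3.2]

theorem sumZeroes_T {m : ℕ} {a : ℤ} (ha : |a| ≤ 2 * m) :
    Polynomial.Chebyshev.sumZeroes (m + 1) (Polynomial.Chebyshev.T ℝ a) =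
      if a = 0 then Real.pi else 0 := by
  split_ifs with h
  · rw [h, Polynomial.Chebyshev.sumZeroes_T_zero (Nat.succ_ne_zero m)]
  · refine Polynomial.Chebyshev.sumZeroes_T_of_not_dvd fun hdvd => ?_
    have := Int.le_of_dvd (abs_pos.mpr h) ((dvd_abs _ _).mpr hdvd)
    push_cast at this
    omega

/-- Discrete orthogonality of the Chebyshev polynomials on the nodes. -/
theorem chebyshevCoeff_T {m k j : ℕ} (hk : k ≤ m) (hj : j ≤ m) :
    chebyshevCoeff (fun x => (Polynomial.Chebyshev.T ℝ (k : ℤ)).eval x) m j =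
      if j = k then (if k = 0 then 2 else 1) else 0 := by
  have h1 : chebyshevCoeff (fun x => (Polynomial.Chebyshev.T ℝ (k : ℤ)).eval x) m j =
      1 / Real.pi * (Polynomial.Chebyshev.sumZeroes (m + 1) (Polynomial.Chebyshev.T ℝ (k + j : ℤ)) +
        Polynomial.Chebyshev.sumZeroes (m + 1) (Polynomial.Chebyshev.T ℝ (k - j : ℤ))) := by
    rw [chebyshevCoeff, Polynomial.Chebyshev.sumZeroes, Polynomial.Chebyshev.sumZeroes, ← mul_add,
      ← Finset.sum_add_distrib, ← mul_assoc, Finset.mul_sum, Finset.mul_sum]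
    refine Finset.sum_congr rfl fun i _ => ?_
    have hnode : Real.cos ((2 * (i : ℝ) + 1) / (2 * ((m + 1 : ℕ) : ℝ)) * Real.pi) =
        chebyshevNode m i := by
      rw [chebyshevNode]
      congr 1
      push_cast
      field_simp
    rw [hnode, ← Polynomial.eval_add, ← Polynomial.Chebyshev.T_mul_T, Polynomial.eval_mul,
      Polynomial.eval_mul]
    push_cast
    have := Real.pi_ne_zero
    simp
    field_simp
  rw [h1, sumZeroes_T (by rw [abs_le]; omega), sumZeroes_T (by rw [abs_le]; omega)]
  have := Real.pi_ne_zero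
  split_ifs <;> first | omega | (field_simp; norm_num)

theorem chebyshevError_T {m : ℕ} {a : ℤ} (ha : a.natAbs ≤ m) (x : ℝ) :
    chebyshevError m x (fun y => (Polynomial.Chebyshev.T ℝ a).eval y) = 0 := by
  rw [← Polynomial.Chebyshev.T_natAbs]
  set k := a.natAbs
  rw [chebyshevError_eq, chebyshevCoeff_T ha (Nat.zero_le m)]
  have h : ∑ j ∈ Finset.Icc 1 m, chebyshevCoeff
      (fun y => (Polynomial.Chebyshev.T ℝ (k : ℤ)).eval y) m j *
        (Polynomial.Chebyshev.T ℝ (j : ℤ)).eval x =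
      if k = 0 then 0 else (Polynomial.Chebyshev.T ℝ (k : ℤ)).eval x := by
    have h2 : ∀ j ∈ Finset.Icc 1 m, chebyshevCoeff
        (fun y => (Polynomial.Chebyshev.T ℝ (k : ℤ)).eval y) m j *
        (Polynomial.Chebyshev.T ℝ (j : ℤ)).eval x =
        if j = k then (Polynomial.Chebyshev.T ℝ (k : ℤ)).eval x else 0 := by
      intro j hj
      rw [Finset.mem_Icc] at hj
      rw [chebyshevCoeff_T ha hj.2]
      by_cases hjk : j = k
      · have hk0 : k ≠ 0 := by omega
        simp [hjk, hk0]
      · simp [hjk]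
    rw [Finset.sum_congr rfl h2, Finset.sum_ite_eq']
    simp only [Finset.mem_Icc]
    split_ifs <;> first | omega | rfl
  rw [h]
  by_cases hk0 : k = 0
  · simp [hk0]
  · simp [hk0, Ne.symm hk0]

/-- The interpolation error of `T_a X^j`, by induction on `j` from the recurrence
`2 X T_a = T_(a+1) + T_(a-1)`; the same recurrence holds for `cosh (a θ)`. -/
theorem abs_chebyshevError_T_mul_pow_le {m : ℕ} {x : ℝ} (θ : ℝ) (hx : |x| ≤ 1) (j : ℕ) :
    ∀ a : ℤ, |chebyshevError m x fun y => (Polynomial.Chebyshev.T ℝ a).eval y * y ^ j| ≤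
      (2 * m + 2) * (Real.cosh (a * θ) * Real.cosh θ ^ j) / Real.cosh (m * θ) := by
  induction j with
  | zero =>
    intro a
    simp only [pow_zero, mul_one]
    rcases le_or_gt a.natAbs m with h | h
    · rw [chebyshevError_T h, abs_zero]
      have := Real.cosh_pos (a * θ)
      have := Real.cosh_pos (m * θ)
      positivity
    · have h1 : |chebyshevError m x fun y => (Polynomial.Chebyshev.T ℝ a).eval y| ≤ 2 * m + 2 :=
        abs_chebyshevError_le hx fun y hy => Polynomial.Chebyshev.abs_eval_T_real_le_one a hy
      rw [le_div_iff₀ (Real.cosh_pos _)]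
      have h2 : Real.cosh (m * θ) ≤ Real.cosh (a * θ) := by
        rw [Real.cosh_le_cosh, abs_mul, abs_mul, Nat.abs_cast]
        have h3 : (m : ℝ) ≤ |(a : ℝ)| := by
          rw [← Int.cast_abs, Int.abs_eq_natAbs]
          exact_mod_cast h.le
        gcongr
      have := Real.cosh_pos (m * θ)
      gcongr
  | succ j ih =>
    intro a
    have hrec : (chebyshevError m x fun y => (Polynomial.Chebyshev.T ℝ a).eval y * y ^ (j + 1)) =
        1 / 2 * ((chebyshevError m x fun y => (Polynomial.Chebyshev.T ℝ (a + 1)).eval y * y ^ j) +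
          chebyshevError m x fun y => (Polynomial.Chebyshev.T ℝ (a - 1)).eval y * y ^ j) := by
      have hT : ∀ y : ℝ, (Polynomial.Chebyshev.T ℝ a).eval y * y ^ (j + 1) =
          1 / 2 * ((Polynomial.Chebyshev.T ℝ (a + 1)).eval y * y ^ j +
            (Polynomial.Chebyshev.T ℝ (a - 1)).eval y * y ^ j) := by
        intro y
        rw [Polynomial.Chebyshev.T_add_one]
        simp
        ring
      simp only [chebyshevError, hT, add_mul, mul_add, Finset.sum_add_distrib, mul_assoc,
        ← Finset.mul_sum]
      ring
    have hcosh : Real.cosh (a * θ) * Real.cosh θ =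
        1 / 2 * (Real.cosh ((a + 1 : ℤ) * θ) + Real.cosh ((a - 1 : ℤ) * θ)) := by
      push_cast
      rw [add_mul, sub_mul, one_mul, Real.cosh_add, Real.cosh_sub]
      ring
    rw [hrec, abs_mul, abs_of_pos (by norm_num : (0 : ℝ) < 1 / 2)]
    calc _ ≤ 1 / 2 * (_ + _) :=
          mul_le_mul_of_nonneg_left ((abs_add_le _ _).trans (add_le_add (ih (a + 1)) (ih (a - 1))))
            (by norm_num)
      _ = (2 * m + 2) * ((1 / 2 * (Real.cosh ((a + 1 : ℤ) * θ) + Real.cosh ((a - 1 : ℤ) * θ))) *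
            Real.cosh θ ^ j) / Real.cosh (m * θ) := by ring
      _ = _ := by rw [← hcosh]; ring

theorem abs_chebyshevError_pow_le {m : ℕ} {x : ℝ} (θ : ℝ) (hx : |x| ≤ 1) (j : ℕ) :
    |chebyshevError m x fun y => y ^ j| ≤
      (2 * m + 2) * Real.cosh θ ^ j / Real.cosh (m * θ) := by
  simpa using abs_chebyshevError_T_mul_pow_le (m := m) θ hx j 0

/-- The factors `|α - j| / (j + 1)` of the binomial coefficient are at most one once `j ≥ β`, so
the coefficients are bounded uniformly in `α ≤ β`. -/
theorem abs_choose_le {α β : ℝ} (hα : 0 < α) (hαβ : α ≤ β) (j : ℕ) :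
    |Ring.choose α j| ≤ (1 + β) ^ ⌈β⌉₊ := by
  have hβ : 0 < β := hα.trans_le hαβ
  have hrec : ∀ j : ℕ, ((j : ℝ) + 1) * Ring.choose α (j + 1) = Ring.choose α j * (α - j) := by
    intro j
    have h := Ring.choose_smul_choose α (n := j + 1) (k := j) (Nat.le_succ j)
    rw [Nat.add_sub_cancel_left, Ring.choose_one_right, nsmul_eq_mul] at h
    simpa using h
  have hmain : ∀ j : ℕ, |Ring.choose α j| ≤ (1 + β) ^ (min j ⌈β⌉₊) := by
    intro j
    induction j with
    | zero => simp
    | succ j ih =>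
      have hj : (0 : ℝ) < j + 1 := by positivity
      have h1 : |Ring.choose α (j + 1)| = |Ring.choose α j| * (|α - j| / (j + 1)) := by
        have h2 := congrArg abs (hrec j)
        rw [abs_mul, abs_mul, abs_of_pos hj] at h2
        rw [mul_div_assoc', ← h2]
        field_simp
      rw [h1]
      by_cases hc : j < ⌈β⌉₊
      · rw [show min (j + 1) ⌈β⌉₊ = j + 1 by omega, pow_succ]
        rw [show min j ⌈β⌉₊ = j by omega] at ih
        have h3 : |α - j| / (j + 1) ≤ 1 + β := by
          rw [div_le_iff₀ hj, abs_le]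
          have hj0 : (0 : ℝ) ≤ j := Nat.cast_nonneg j
          constructor <;> nlinarith [mul_nonneg hβ.le hj0]
        gcongr
      · rw [show min (j + 1) ⌈β⌉₊ = ⌈β⌉₊ by omega]
        rw [show min j ⌈β⌉₊ = ⌈β⌉₊ by omega] at ih
        have h4 : β ≤ j := (Nat.le_ceil β).trans (by exact_mod_cast not_lt.mp hc)
        have h3 : |α - j| / (j + 1) ≤ 1 := by
          rw [div_le_one hj, abs_le]
          constructor <;> linarith
        exact (mul_le_of_le_one_right (abs_nonneg _) h3).trans ih
  exact (hmain j).trans (pow_le_pow_right₀ (by linarith) (min_le_right _ _))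

theorem hasSum_one_add_rpow (α : ℝ) {y : ℝ} (hy : |y| < 1) :
    HasSum (fun j : ℕ => Ring.choose α j * y ^ j) ((1 + y) ^ α) := by
  have h := (Real.one_add_rpow_hasFPowerSeriesOnBall_zero (a := α)).hasSum (y := y)
    (by simpa [Metric.mem_eball, edist_dist, dist_zero_right] using hy)
  simp only [binomialSeries_apply, zero_add] at h
  simpa using h

/-- The expansion of `(1 + r x) ^ α` in powers of `x` is absolutely convergent up to the boundary
of a Bernstein ellipse of parameter `θ` as long as `r cosh θ < 1`. -/
theorem abs_chebyshevError_one_add_rpow_le {m : ℕ} {x θ r α β : ℝ} (hx : |x| ≤ 1)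
    (hα : 0 < α) (hαβ : α ≤ β) (hr0 : 0 ≤ r) (hr : r * Real.cosh θ < 1) :
    |chebyshevError m x fun y => (1 + r * y) ^ α| ≤
      (2 * m + 2) / Real.cosh (m * θ) * ((1 + β) ^ ⌈β⌉₊ * (1 - r * Real.cosh θ)⁻¹) := by
  have hr1 : r < 1 := lt_of_le_of_lt (by nlinarith [Real.one_le_cosh θ]) hr
  have hsum : ∀ y, |y| ≤ 1 → HasSum (fun j : ℕ => Ring.choose α j * r ^ j * y ^ j)
      ((1 + r * y) ^ α) := by
    intro y hy
    have h := hasSum_one_add_rpow α (y := r * y) (by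
      rw [abs_mul, abs_of_nonneg hr0]; nlinarith [abs_nonneg y])
    simpa only [mul_pow, mul_assoc] using h
  have herr : HasSum (fun j : ℕ => Ring.choose α j * r ^ j * chebyshevError m x fun y => y ^ j)
      (chebyshevError m x fun y => (1 + r * y) ^ α) := by
    have h1 := hasSum_sum (s := Finset.range (m + 1)) fun i _ =>
      (hsum _ (abs_chebyshevNode_le_one m i)).mul_right (chebyshevWeight m i x)
    simpa only [chebyshevError, mul_sub, Finset.mul_sum, mul_assoc] using (hsum x hx).sub h1
  have hgeo : HasSum (fun j : ℕ => (2 * m + 2) / Real.cosh (m * θ) *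
      ((1 + β) ^ ⌈β⌉₊ * (r * Real.cosh θ) ^ j))
      ((2 * m + 2) / Real.cosh (m * θ) * ((1 + β) ^ ⌈β⌉₊ * (1 - r * Real.cosh θ)⁻¹)) :=
    ((hasSum_geometric_of_lt_one (by have := Real.cosh_pos θ; positivity) hr).mul_left _).mul_left _
  refine herr.norm_le_of_bounded hgeo fun j => ?_
  rw [Real.norm_eq_abs, abs_mul, abs_mul, abs_of_nonneg (pow_nonneg hr0 j)]
  have h1 := abs_choose_le hα hαβ j
  have h2 := abs_chebyshevError_pow_le (m := m) θ hx j
  calc _ ≤ (1 + β) ^ ⌈β⌉₊ * r ^ j * ((2 * m + 2) * Real.cosh θ ^ j / Real.cosh (m * θ)) := by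
        have hβ : 0 ≤ 1 + β := by linarith
        gcongr
    _ = _ := by rw [mul_pow]; ring

theorem eval_chebyshevApprox (f : ℝ → ℝ) {u v y : ℝ} (huv : u < v) (m : ℕ) :
    (chebyshevApprox f u v m).eval y = f y - chebyshevError m ((2 * y - (u + v)) / (v - u))
      fun x => f (fromUnitInterval u v x) := by
  have h0 : v - u ≠ 0 := by linarith
  have h1 : (toUnitInterval u v).eval y = (2 * y - (u + v)) / (v - u) := by
    simp only [toUnitInterval, Polynomial.eval_sub, Polynomial.eval_mul, Polynomial.eval_C,
      Polynomial.eval_X]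
    ring
  have h2 : fromUnitInterval u v ((2 * y - (u + v)) / (v - u)) = y := by
    rw [fromUnitInterval]; field_simp; ring
  rw [chebyshevError_eq, h2, sub_sub_cancel]
  simp only [chebyshevApprox, Polynomial.eval_add, Polynomial.eval_C, Polynomial.eval_finsetSum,
    Polynomial.eval_mul, Polynomial.eval_comp, h1]

theorem chebyshevError_const_mul (m : ℕ) (x c : ℝ) (g : ℝ → ℝ) :
    (chebyshevError m x fun y => c * g y) = c * chebyshevError m x g := by
  simp only [chebyshevError, mul_sub, Finset.mul_sum, mul_assoc]

/-- The error of Chebyshev interpolation of `t ^ α` on an interval of condition number `κ`. -/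
theorem abs_eval_chebyshevApprox_rpow_sub_le {u v κ y α β : ℝ} (hu : 0 < u) (hκ : 1 < κ)
    (hv : v = κ * u) (hα : 0 < α) (hαβ : α ≤ β) (hy : y ∈ Set.Icc u v) (m : ℕ) :
    |(chebyshevApprox (fun t => t ^ α) u v m).eval y - y ^ α| ≤
      4 * (m + 1) * (1 + β) ^ ⌈β⌉₊ * κ ^ (β + 1) * Real.exp (-(m / √κ)) * u ^ α := by
  have hκ0 : 0 < κ := by linarith
  have huv : u < v := by rw [hv]; nlinarith
  have hβ : 0 < β := hα.trans_le hαβ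
  set x := (2 * y - (u + v)) / (v - u) with hx
  have hx1 : |x| ≤ 1 := by
    rw [hx, abs_div, abs_of_pos (by linarith : 0 < v - u), div_le_one (by linarith), abs_le]
    constructor <;> linarith [hy.1, hy.2]
  set r := (κ - 1) / (κ + 1) with hr
  have hr0 : 0 ≤ r := div_nonneg (by linarith) (by linarith)
  have hr1 : r < 1 := by rw [hr, div_lt_one (by linarith)]; linarith
  set θ := 1 / √κ with hθ
  have hθ2 : θ ^ 2 = 1 / κ := by rw [hθ, div_pow, one_pow, Real.sq_sqrt hκ0.le]
  -- `cosh θ ≤ exp (1 / (2 κ)) ≤ 1 + 1 / κ`, so `r cosh θ ≤ 1 - 1 / κ`.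
  have hcosh : Real.cosh θ ≤ (κ + 1) / κ := by
    refine (Real.cosh_le_exp_half_sq θ).trans ?_
    have h1 := Real.add_one_le_exp (-(θ ^ 2 / 2))
    rw [Real.exp_neg] at h1
    have h2 : 0 < -(θ ^ 2 / 2) + 1 := by
      rw [hθ2]
      have : 1 / κ < 1 := by rw [div_lt_one hκ0]; exact hκ
      linarith
    have h3 : Real.exp (θ ^ 2 / 2) ≤ (-(θ ^ 2 / 2) + 1)⁻¹ := by
      rw [le_inv_comm₀ (Real.exp_pos _) h2]; exact h1
    refine h3.trans ?_
    rw [inv_le_comm₀ h2 (by positivity), inv_div, hθ2, div_le_iff₀ (by linarith)]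
    have h4 : (-(1 / κ / 2) + 1) * (κ + 1) = κ + (κ - 1) / (2 * κ) := by field_simp; ring
    rw [h4]
    have : 0 ≤ (κ - 1) / (2 * κ) := div_nonneg (by linarith) (by linarith)
    linarith
  have hrc : r * Real.cosh θ ≤ 1 - 1 / κ := by
    calc r * Real.cosh θ ≤ r * ((κ + 1) / κ) := by gcongr
      _ = 1 - 1 / κ := by rw [hr]; field_simp
  have hκinv : 0 < 1 / κ := by positivity
  have herr := abs_chebyshevError_one_add_rpow_le (m := m) hx1 hα hαβ hr0
    (lt_of_le_of_lt hrc (by linarith))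
  have hmid : 0 < (u + v) / 2 := by linarith
  have hfun : chebyshevError m x (fun z => fromUnitInterval u v z ^ α) =
      ((u + v) / 2) ^ α * chebyshevError m x fun z => (1 + r * z) ^ α := by
    rw [← chebyshevError_const_mul]
    have hpt : ∀ z, |z| ≤ 1 →
        fromUnitInterval u v z ^ α = ((u + v) / 2) ^ α * (1 + r * z) ^ α := by
      intro z hz
      rw [← Real.mul_rpow hmid.le (by nlinarith [(abs_le.mp hz).1]), fromUnitInterval]
      congr 1
      rw [hr, hv]
      field_simp
      ring
    rw [chebyshevError, chebyshevError, hpt x hx1]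
    congr 1
    exact Finset.sum_congr rfl fun i _ => by rw [hpt _ (abs_chebyshevNode_le_one m i)]
  rw [eval_chebyshevApprox _ huv, sub_sub_cancel_left, abs_neg, hfun, abs_mul,
    abs_of_nonneg (Real.rpow_nonneg hmid.le α)]
  have h1 : ((u + v) / 2) ^ α ≤ κ ^ β * u ^ α := by
    calc ((u + v) / 2) ^ α ≤ (κ * u) ^ α := by
          apply Real.rpow_le_rpow hmid.le _ hα.le
          rw [← hv]; linarith
      _ = κ ^ α * u ^ α := Real.mul_rpow hκ0.le hu.le
      _ ≤ _ := by
          gcongr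
          exact hκ.le
  have h2 : (1 - r * Real.cosh θ)⁻¹ ≤ κ := by
    rw [inv_le_comm₀ (by linarith) hκ0, ← one_div]; linarith
  have h3 : (2 * (m : ℝ) + 2) / Real.cosh (m * θ) ≤ 4 * (m + 1) * Real.exp (-(m / √κ)) := by
    have h4 : Real.exp (m / √κ) / 2 ≤ Real.cosh (m * θ) := by
      rw [Real.cosh_eq, hθ, mul_one_div]
      have := Real.exp_pos (-(m / √κ))
      linarith
    rw [div_le_iff₀ (Real.cosh_pos _), Real.exp_neg]
    have h5 := Real.exp_pos (m / √κ)
    calc 2 * (m : ℝ) + 2 = 4 * (m + 1) * (Real.exp (m / √κ))⁻¹ * (Real.exp (m / √κ) / 2) := by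
          field_simp; ring
      _ ≤ _ := by gcongr
  have hβ1 : 0 ≤ 1 + β := by linarith
  have h6 : 0 ≤ (1 - r * Real.cosh θ)⁻¹ := inv_nonneg.mpr (by linarith)
  calc _ ≤ κ ^ β * u ^ α * ((2 * m + 2) / Real.cosh (m * θ) *
        ((1 + β) ^ ⌈β⌉₊ * (1 - r * Real.cosh θ)⁻¹)) := by gcongr
    _ ≤ κ ^ β * u ^ α * (4 * (m + 1) * Real.exp (-(m / √κ)) * ((1 + β) ^ ⌈β⌉₊ * κ)) := by
        gcongr
    _ = _ := by rw [Real.rpow_add_one hκ0.ne']; ring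

/-- The degree `m ≳ √κ log (κ / τ)` makes the error of the interpolant of `t ^ α` a small multiple
of `τ u ^ α`, uniformly in bounded `α`. -/
theorem exists_abs_eval_chebyshevApprox_rpow_sub_le (β : ℝ) {c : ℝ} (hc : 0 < c) :
    ∃ Cm : ℝ, 0 < Cm ∧ ∀ {u v κ y α τ : ℝ} {m : ℕ}, 0 < u → 4 ≤ κ → v = κ * u → 0 < α → α ≤ β →
      0 < τ → τ ≤ 1 → Cm * (√κ * Real.log (κ / τ)) ≤ m → y ∈ Set.Icc u v →
      |(chebyshevApprox (fun t => t ^ α) u v m).eval y - y ^ α| ≤ c * τ * u ^ α := by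
  rcases le_or_gt β 0 with hβ | hβ
  · exact ⟨1, one_pos, fun _ _ _ hα hαβ => absurd (hα.trans_le hαβ) (not_lt.mpr hβ)⟩
  set K : ℝ := 32 * (1 + β) ^ ⌈β⌉₊ with hK
  have hK0 : 0 < K := by positivity
  set E : ℝ := K / c with hE
  have hE0 : 0 < E := by positivity
  refine ⟨2 * (β + 3 + E), by positivity, ?_⟩
  intro u v κ y α τ m hu hκ hv hα hαβ hτ0 hτ1 hm hy
  have hκ0 : 0 < κ := by linarith
  have hsκ : 0 < √κ := Real.sqrt_pos.mpr hκ0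
  set X := κ / τ with hX
  have hXκ : κ ≤ X := by rw [hX, le_div_iff₀ hτ0]; nlinarith
  have hX0 : 0 < X := by linarith
  have hlog1 : 1 ≤ Real.log X := by
    rw [Real.le_log_iff_exp_le hX0]
    have := Real.exp_one_lt_d9
    linarith
  set z := m / √κ with hz
  have hzlog : (β + 3 + E) * Real.log X ≤ z / 2 := by
    rw [hz, le_div_iff₀ two_pos, le_div_iff₀ hsκ]
    linarith
  have hz0 : 1 ≤ z := by nlinarith
  have hmz : (m : ℝ) + 1 ≤ 2 * κ * z := by
    have h1 : (m : ℝ) = z * √κ := by rw [hz]; field_simp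
    have h2 : √κ ≤ κ := by
      rw [Real.sqrt_le_left hκ0.le]; nlinarith
    rw [h1]
    nlinarith
  have hzexp : z ≤ 2 * Real.exp (z / 2) := by
    have := Real.add_one_le_exp (z / 2)
    linarith
  have hexp : Real.exp (-(z / 2)) ≤ X ^ (-(β + 3 + E)) := by
    rw [Real.rpow_def_of_pos hX0]
    exact Real.exp_le_exp.mpr (by linarith)
  have hXE : X ^ (-E) ≤ c / K := by
    rw [Real.rpow_neg hX0.le, inv_le_comm₀ (by positivity) (by positivity), inv_div, ← hE]
    calc E ≤ Real.exp E := by linarith [Real.add_one_le_exp E]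
      _ ≤ Real.exp (Real.log X * E) := Real.exp_le_exp.mpr (by nlinarith)
      _ = X ^ E := (Real.rpow_def_of_pos hX0 E).symm
  have hβ1 : 0 ≤ 1 + β := by linarith
  refine (abs_eval_chebyshevApprox_rpow_sub_le hu (by linarith) hv hα hαβ hy m).trans ?_
  have huα : 0 < u ^ α := Real.rpow_pos_of_pos hu α
  refine mul_le_mul_of_nonneg_right ?_ huα.le
  calc 4 * ((m : ℝ) + 1) * (1 + β) ^ ⌈β⌉₊ * κ ^ (β + 1) * Real.exp (-z)
      ≤ 4 * (2 * κ * (2 * Real.exp (z / 2))) * (1 + β) ^ ⌈β⌉₊ * κ ^ (β + 1) * Real.exp (-z) := by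
        gcongr
        exact hmz.trans (by gcongr)
    _ = K / 2 * κ ^ (β + 2) * Real.exp (-(z / 2)) := by
        rw [show β + 2 = β + 1 + 1 by ring, Real.rpow_add_one hκ0.ne' (β + 1), hK,
          show -z = -(z / 2) + -(z / 2) by ring, Real.exp_add, Real.exp_neg]
        field_simp
        ring
    _ ≤ K * X ^ (β + 2) * X ^ (-(β + 3 + E)) := by
        gcongr
        linarith
    _ = K * X⁻¹ * X ^ (-E) := by
        rw [mul_assoc K, ← Real.rpow_add hX0, mul_assoc K, ← Real.rpow_neg_one,
          ← Real.rpow_add hX0]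
        congr 2; ring
    _ ≤ K * τ * (c / K) := by
        gcongr
        rw [hX, inv_div]
        exact div_le_self hτ0.le (by linarith)
    _ = c * τ := by field_simp

/-! ### Rényi entropy and the tail of the spectrum -/

section

variable {n : ℕ} {w : Fin n → ℝ} {i₀ : Fin n}

/-- The Rényi entropy controls the part of `∑ w_i ^ α` that lies off the largest weight. -/
theorem tail_div_le_abs_log_sum_rpow {α : ℝ} (hα0 : 0 < α) (hα1 : α ≠ 1) (hw : ∀ i, 0 < w i)
    (hsum : ∑ i, w i = 1) (hmax : ∀ i, w i ≤ w i₀) :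
    0 ≤ (1 - α) * Real.log (∑ i, w i ^ α) ∧
    |α - 1| * (∑ i ∈ Finset.univ.erase i₀, w i ^ α) / (2 * ∑ i, w i ^ α) ≤
      |Real.log (∑ i, w i ^ α)| := by
  set T := ∑ i ∈ Finset.univ.erase i₀, w i ^ α with hT
  set R := ∑ i, w i ^ α with hR
  have hpow : ∀ i, 0 < w i ^ α := fun i => Real.rpow_pos_of_pos (hw i) α
  have hRT : w i₀ ^ α + T = R := Finset.add_sum_erase _ (fun i => w i ^ α) (Finset.mem_univ i₀)
  have hw1 : w i₀ + ∑ i ∈ Finset.univ.erase i₀, w i = 1 := by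
    rw [← hsum]; exact Finset.add_sum_erase _ w (Finset.mem_univ i₀)
  have hT0 : 0 ≤ T := Finset.sum_nonneg fun i _ => (hpow i).le
  have hR0 : 0 < R := by have := hpow i₀; linarith
  have htail0 : 0 ≤ ∑ i ∈ Finset.univ.erase i₀, w i := Finset.sum_nonneg fun i _ => (hw i).le
  rcases lt_or_gt_of_ne hα1 with hlt | hgt
  · -- For `α < 1` the tail already accounts for the excess of `R` over `∑ w_i = 1`.
    have hexc : (1 - α) / 2 * T ≤ R - 1 := by
      have h1 : w i₀ ≤ w i₀ ^ α := by
        have := Real.rpow_le_rpow_of_exponent_ge (hw i₀) (by linarith) hlt.le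
        rwa [Real.rpow_one] at this
      have h2 : ∀ i ∈ Finset.univ.erase i₀, (1 - α) / 2 * w i ^ α ≤ w i ^ α - w i := by
        intro i hi
        have hi2 : w i ≤ 1 / 2 := by
          have h3 := Finset.single_le_sum (f := w) (fun j _ => (hw j).le) hi
          linarith [hmax i]
        have h4 : w i ^ (1 - α) ≤ 1 - (1 - α) / 2 := by
          calc w i ^ (1 - α) ≤ (1 + -(1 / 2)) ^ (1 - α) :=
                Real.rpow_le_rpow (hw i).le (by linarith) (by linarith)
            _ ≤ 1 + (1 - α) * -(1 / 2) :=
                rpow_one_add_le_one_add_mul_self (by norm_num) (by linarith) (by linarith)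
            _ = _ := by ring
        have h5 : w i = w i ^ α * w i ^ (1 - α) := by
          rw [← Real.rpow_add (hw i)]; simp
        have h6 := mul_le_mul_of_nonneg_left h4 (hpow i).le
        linarith
      have h3 := Finset.sum_le_sum h2
      rw [← Finset.mul_sum, Finset.sum_sub_distrib] at h3
      linarith
    have hR1 : 1 ≤ R := by
      have : 0 ≤ (1 - α) / 2 * T := mul_nonneg (by linarith) hT0
      linarith
    have hlog : (R - 1) / R ≤ Real.log R := by
      have := Real.one_sub_inv_le_log_of_pos hR0
      rwa [sub_div, div_self hR0.ne', one_div]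
    refine ⟨mul_nonneg (by linarith) (Real.log_nonneg hR1), ?_⟩
    rw [abs_of_nonneg (Real.log_nonneg hR1), abs_of_neg (by linarith)]
    refine le_trans ?_ hlog
    rw [div_le_div_iff₀ (by positivity) hR0]
    nlinarith
  · have hle : ∀ i, w i ^ α ≤ w i * w i₀ ^ (α - 1) := by
      intro i
      have h1 : w i ^ α = w i * w i ^ (α - 1) := by
        conv_rhs => rw [← Real.rpow_one (w i), ← Real.rpow_mul (hw i).le, one_mul,
          ← Real.rpow_add (hw i)]
        congr 1; ring
      rw [h1]
      exact mul_le_mul_of_nonneg_left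
        (Real.rpow_le_rpow (hw i).le (hmax i) (by linarith)) (hw i).le
    have hRle : R ≤ w i₀ ^ (α - 1) := by
      calc R ≤ ∑ i, w i * w i₀ ^ (α - 1) := Finset.sum_le_sum fun i _ => hle i
        _ = _ := by rw [← Finset.sum_mul, hsum, one_mul]
    have hTle : T ≤ (1 - w i₀) * w i₀ ^ (α - 1) := by
      calc T ≤ ∑ i ∈ Finset.univ.erase i₀, w i * w i₀ ^ (α - 1) :=
            Finset.sum_le_sum fun i _ => hle i
        _ = _ := by rw [← Finset.sum_mul]; congr 1; linarith
    have hTR : T ≤ (1 - w i₀) * R := by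
      have h1 : w i₀ ^ α = w i₀ * w i₀ ^ (α - 1) := by
        conv_rhs => rw [← Real.rpow_one (w i₀), ← Real.rpow_mul (hw i₀).le, one_mul,
          ← Real.rpow_add (hw i₀)]
        congr 1; ring
      have h2 := mul_le_mul_of_nonneg_left hTle (hw i₀).le
      rw [← hRT, h1]
      linarith
    have hlog : Real.log R ≤ (α - 1) * Real.log (w i₀) := by
      rw [← Real.log_rpow (hw i₀)]
      exact Real.log_le_log hR0 hRle
    have hlogw : Real.log (w i₀) ≤ w i₀ - 1 := Real.log_le_sub_one_of_pos (hw i₀)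
    have hmain : (α - 1) * (1 - w i₀) ≤ -Real.log R := by nlinarith
    have hneg : Real.log R ≤ 0 := by
      have : 0 ≤ (α - 1) * (1 - w i₀) := mul_nonneg (by linarith) (by linarith)
      linarith
    refine ⟨mul_nonneg_of_nonpos_of_nonpos (by linarith) hneg, ?_⟩
    rw [abs_of_nonpos hneg, abs_of_pos (by linarith)]
    refine le_trans ?_ hmain
    rw [div_le_iff₀ (by positivity)]
    have h3 := mul_le_mul_of_nonneg_left hTR (by linarith : (0 : ℝ) ≤ α - 1)
    have h4 : 0 ≤ (α - 1) * T := mul_nonneg (by linarith) hT0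
    nlinarith

/-- An estimate `Z` of `∑ w_i ^ α` whose error is small relative to the tail of the weights gives
an estimate of the Rényi entropy with small relative error. -/
theorem abs_log_sub_log_sum_rpow_le {α ε Z : ℝ} (hα0 : 0 < α) (hα1 : α ≠ 1)
    (hε : 0 < ε) (hw : ∀ i, 0 < w i) (hsum : ∑ i, w i = 1) (hmax : ∀ i, w i ≤ w i₀)
    (hZ : |Z - ∑ i, w i ^ α| ≤
      min 1 (ε * |α - 1|) / 8 * ∑ i ∈ Finset.univ.erase i₀, w i ^ α) :
    |1 / (1 - α) * Real.log Z - 1 / (1 - α) * Real.log (∑ i, w i ^ α)| ≤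
      ε * (1 / (1 - α) * Real.log (∑ i, w i ^ α)) := by
  obtain ⟨hnn, htail⟩ := tail_div_le_abs_log_sum_rpow hα0 hα1 hw hsum hmax
  set T := ∑ i ∈ Finset.univ.erase i₀, w i ^ α with hT
  set R := ∑ i, w i ^ α with hR
  have hpow : ∀ i, 0 < w i ^ α := fun i => Real.rpow_pos_of_pos (hw i) α
  have hRT : w i₀ ^ α + T = R := Finset.add_sum_erase _ (fun i => w i ^ α) (Finset.mem_univ i₀)
  have hT0 : 0 ≤ T := Finset.sum_nonneg fun i _ => (hpow i).le
  have hR0 : 0 < R := by have := hpow i₀; linarith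
  have hTR : T ≤ R := by have := hpow i₀; linarith
  have hZ1 : |Z - R| ≤ T / 8 := by
    refine hZ.trans ?_
    have := min_le_left 1 (ε * |α - 1|)
    nlinarith
  have hZ2 : |Z - R| ≤ ε * |α - 1| / 8 * T := by
    refine hZ.trans ?_
    have := min_le_right 1 (ε * |α - 1|)
    gcongr
  have hZhalf : R / 2 ≤ Z := by
    have := (abs_le.mp hZ1).1
    linarith
  have hZ0 : 0 < Z := by linarith
  have hlog : |Real.log Z - Real.log R| ≤ 2 * |Z - R| / R := by
    rw [← Real.log_div hZ0.ne' hR0.ne']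
    have hq : 0 < Z / R := by positivity
    have h1 := Real.log_le_sub_one_of_pos hq
    have h2 := Real.one_sub_inv_le_log_of_pos hq
    have h3 : Z / R - 1 = (Z - R) / R := by field_simp
    have h4 : 1 - (Z / R)⁻¹ = (Z - R) / Z := by field_simp
    rw [h3] at h1
    rw [h4] at h2
    have h5 : (Z - R) / R ≤ 2 * |Z - R| / R := by
      gcongr
      linarith [le_abs_self (Z - R), abs_nonneg (Z - R)]
    have h6 : -(2 * |Z - R| / R) ≤ (Z - R) / Z := by
      have h7 : |(Z - R) / Z| ≤ 2 * |Z - R| / R := by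
        rw [abs_div, abs_of_pos hZ0, div_le_div_iff₀ hZ0 hR0]
        nlinarith [abs_nonneg (Z - R)]
      linarith [neg_abs_le ((Z - R) / Z)]
    rw [abs_le]
    constructor <;> linarith
  have hkey : |Real.log Z - Real.log R| ≤ ε * |Real.log R| := by
    calc |Real.log Z - Real.log R| ≤ 2 * (ε * |α - 1| / 8 * T) / R := by
          refine hlog.trans ?_
          gcongr
      _ ≤ ε * (|α - 1| * T / (2 * R)) := by
          rw [← sub_nonneg]
          have : ε * (|α - 1| * T / (2 * R)) - 2 * (ε * |α - 1| / 8 * T) / R =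
              ε * |α - 1| * T / (4 * R) := by field_simp; ring
          rw [this]
          positivity
      _ ≤ _ := by gcongr
  have hα2 : 1 - α ≠ 0 := sub_ne_zero.mpr (Ne.symm hα1)
  have hS : 1 / (1 - α) * Real.log R = |1 / (1 - α)| * |Real.log R| := by
    rw [← abs_mul, eq_comm, abs_eq_self]
    have : 1 / (1 - α) * Real.log R = (1 - α) * Real.log R / (1 - α) ^ 2 := by field_simp
    rw [this]
    positivity
  rw [← mul_sub, abs_mul, hS]
  calc _ ≤ |1 / (1 - α)| * (ε * |Real.log R|) := by gcongr
    _ = _ := by ring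

theorem exists_top_subset (w : Fin n → ℝ) (r : ℕ) (hr : r ≤ n) :
    ∃ I : Finset (Fin n), I.card = r ∧ ∀ i ∈ I, ∀ j ∉ I, w j ≤ w i := by
  induction r with
  | zero => exact ⟨∅, rfl, by simp⟩
  | succ r ih =>
    obtain ⟨I, hI, htop⟩ := ih (by omega)
    have hne : Iᶜ.Nonempty := by
      rw [← Finset.card_pos, Finset.card_compl, Fintype.card_fin]
      omega
    obtain ⟨j, hj, hjmax⟩ := Finset.exists_max_image Iᶜ w hne
    have hjI : j ∉ I := Finset.mem_compl.mp hj
    refine ⟨insert j I, by rw [Finset.card_insert_of_notMem hjI, hI], ?_⟩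
    intro i hi l hl
    rw [Finset.mem_insert, not_or] at hl
    rcases Finset.mem_insert.mp hi with rfl | hi
    · exact hjmax l (Finset.mem_compl.mpr hl.2)
    · exact htop i hi l hl.2

/-- Off the `r` largest weights, every `w_j ^ α` is at most `1 / r` of the tail. -/
theorem exists_top_subset_tail {α : ℝ} (hα : 0 < α) (hw : ∀ i, 0 < w i) (hn : 0 < n)
    {r : ℕ} (hr : 0 < r) :
    ∃ (I : Finset (Fin n)) (i₀ i₁ : Fin n), I.card ≤ r ∧ (∀ i, w i ≤ w i₀) ∧
      (∀ i ∈ I, w i₁ ≤ w i) ∧ (∀ j ∉ I, w j ≤ w i₁) ∧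
      (∑ j ∈ Iᶜ, w j ^ α ≤ ∑ i ∈ Finset.univ.erase i₀, w i ^ α) ∧
      ∀ j ∉ I, r * w j ^ α ≤ ∑ i ∈ Finset.univ.erase i₀, w i ^ α := by
  obtain ⟨I, hI, htop⟩ := exists_top_subset w (min r n) (min_le_right _ _)
  have hne : I.Nonempty := by rw [← Finset.card_pos, hI]; omega
  obtain ⟨i₀, hi₀, hmax⟩ := Finset.exists_max_image I w hne
  obtain ⟨i₁, hi₁, hmin⟩ := Finset.exists_min_image I w hne
  refine ⟨I, i₀, i₁, by omega, fun i => ?_, hmin, fun j hj => htop i₁ hi₁ j hj, ?_, ?_⟩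
  · by_cases hi : i ∈ I
    · exact hmax i hi
    · exact htop i₀ hi₀ i hi
  · refine Finset.sum_le_sum_of_subset_of_nonneg (fun j hj => ?_)
      fun i _ _ => (Real.rpow_pos_of_pos (hw i) α).le
    rw [Finset.mem_erase]
    refine ⟨?_, Finset.mem_univ _⟩
    rintro rfl
    exact Finset.mem_compl.mp hj hi₀
  · intro j hj
    have hcard : I.card = r := by
      rcases Nat.le_total r n with h | h
      · rw [hI, min_eq_left h]
      · exfalso
        rw [min_eq_right h] at hI
        have : I = Finset.univ := by
          rw [← Finset.card_eq_iff_eq_univ, hI, Fintype.card_fin]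
        exact hj (this ▸ Finset.mem_univ j)
    have hji : j ≠ i₀ := fun h => hj (h ▸ hi₀)
    set J := (insert j I).erase i₀ with hJ
    have hJcard : J.card = r := by
      rw [hJ, Finset.card_erase_of_mem (Finset.mem_insert_of_mem hi₀),
        Finset.card_insert_of_notMem hj, hcard, Nat.add_sub_cancel]
    calc (r : ℝ) * w j ^ α = ∑ _i ∈ J, w j ^ α := by simp [hJcard]
      _ ≤ ∑ i ∈ J, w i ^ α := by
          refine Finset.sum_le_sum fun i hi => Real.rpow_le_rpow (hw j).le ?_ hα.le
          rcases Finset.mem_insert.mp (Finset.mem_of_mem_erase hi) with rfl | h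
          · exact le_rfl
          · exact htop i h j hj
      _ ≤ _ := Finset.sum_le_sum_of_subset_of_nonneg
          (Finset.erase_subset_erase _ (Finset.subset_univ _))
          fun i _ _ => (Real.rpow_pos_of_pos (hw i) α).le

end

/-- Either choice of `B` makes the range finder work: it is enough that, after scaling by `c`, the
squared eigenvalues of `B` dominate `w_i ^ α` on the leading set and are dominated by it off
that set. -/
theorem isSketchable_of_top_subset {n k : ℕ} {w b f : Fin n → ℝ} {α c T : ℝ} {I : Finset (Fin n)}
    (hk : 2 ≤ k) (hw : ∀ i, 0 < w i) (hT : 0 < T) (hc : 0 ≤ c) (hI : I.card ≤ k / 2)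
    (hsum : ∑ j ∈ Iᶜ, w j ^ α ≤ T) (hoff : ∀ j ∉ I, (k / 2 : ℕ) * w j ^ α ≤ T)
    (hf0 : ∀ i, 0 ≤ f i) (hf : ∀ i, f i ≤ 2 * w i ^ α)
    (hbon : ∀ i ∈ I, w i ^ α ≤ 4 * (c * b i ^ 2)) (hboff : ∀ j ∉ I, c * b j ^ 2 ≤ 4 * w j ^ α) :
    IsSketchable k b f I (√(8 * c * k / (128 * T))) (128 * T) := by
  have hk0 : (0 : ℝ) < k := by positivity
  have hpow : ∀ i, 0 < w i ^ α := fun i => Real.rpow_pos_of_pos (hw i) α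
  have hoff' : ∀ j ∉ I, k * w j ^ α ≤ 4 * T := by
    intro j hj
    have h1 : (k : ℝ) ≤ 4 * (k / 2 : ℕ) := by exact_mod_cast (by omega : k ≤ 4 * (k / 2))
    have h2 := hoff j hj
    have h3 := mul_le_mul_of_nonneg_right h1 (hpow j).le
    linarith
  have hsq : ∀ i, (√(8 * c * k / (128 * T)) * b i) ^ 2 = 8 * k / (128 * T) * (c * b i ^ 2) := by
    intro i
    rw [mul_pow, Real.sq_sqrt (by positivity)]
    ring
  have hsqoff : ∀ i ∉ I, (√(8 * c * k / (128 * T)) * b i) ^ 2 ≤ k / (4 * T) * w i ^ α := by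
    intro i hi
    rw [hsq]
    calc _ ≤ 8 * k / (128 * T) * (4 * w i ^ α) :=
          mul_le_mul_of_nonneg_left (hboff i hi) (by positivity)
      _ = _ := by field_simp; norm_num
  refine ⟨by omega, hf0, fun i hi => ?_, fun i hi => ?_, ?_, fun i hi => ?_, ?_⟩
  · rw [hsq]
    have h1 : 128 * T / k * (8 * k / (128 * T) * (c * b i ^ 2)) = 8 * (c * b i ^ 2) := by
      field_simp
    rw [h1]
    linarith [hf i, hbon i hi]
  · rw [le_div_iff₀ hk0]
    have h1 := hf i
    have h2 := hoff' i hi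
    nlinarith
  · calc ∑ i ∈ Iᶜ, f i ≤ ∑ i ∈ Iᶜ, 2 * w i ^ α := Finset.sum_le_sum fun i _ => hf i
      _ = 2 * ∑ i ∈ Iᶜ, w i ^ α := by rw [Finset.mul_sum]
      _ ≤ 128 * T := by linarith
  · refine (hsqoff i hi).trans ?_
    rw [div_mul_eq_mul_div, div_le_one (by positivity)]
    exact hoff' i hi
  · calc _ ≤ ∑ i ∈ Iᶜ, k / (4 * T) * w i ^ α :=
          Finset.sum_le_sum fun i hi => hsqoff i (Finset.mem_compl.mp hi)
      _ = k / (4 * T) * ∑ i ∈ Iᶜ, w i ^ α := by rw [Finset.mul_sum]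
      _ ≤ k / (4 * T) * T := by gcongr
      _ ≤ k := by
          have : k / (4 * T) * T = k / 4 := by field_simp
          rw [this]
          linarith

/-! ### The normalized kernel matrix -/

theorem aeval_mulVec_eq_smul {n : ℕ} {A : Matrix (Fin n) (Fin n) ℝ} {x : Fin n → ℝ} {c : ℝ}
    (h : A.mulVec x = c • x) (p : Polynomial ℝ) :
    (Polynomial.aeval A p).mulVec x = p.eval c • x := by
  induction p using Polynomial.induction_on' with
  | add p q hp hq => rw [map_add, Matrix.add_mulVec, hp, hq, Polynomial.eval_add, add_smul]
  | monomial k a =>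
    have hpow : (A ^ k).mulVec x = c ^ k • x := by
      induction k with
      | zero => simp
      | succ k ih =>
        rw [pow_succ', ← Matrix.mulVec_mulVec, ih, Matrix.mulVec_smul, h, smul_smul, ← pow_succ]
    rw [Polynomial.aeval_monomial, Polynomial.eval_monomial, ← Algebra.smul_def,
      Matrix.smul_mulVec, hpow, smul_smul]

section

variable {X : Type*} {n : ℕ} {k : X → X → ℝ}

/-- The normalized kernel matrix has unit trace as soon as its eigenvalues are positive, since
then no diagonal entry of the kernel matrix vanishes. -/
theorem sum_eigenvalues_normalizedKernelMatrix (hk : IsInfinitelyDivisibleKernel k)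
    (x : Fin n → X) (hn : 0 < n)
    (hpos : ∀ i, 0 < (normalizedKernelMatrix_isHermitian hk x).eigenvalues i) :
    ∑ i, (normalizedKernelMatrix_isHermitian hk x).eigenvalues i = 1 := by
  set hA := normalizedKernelMatrix_isHermitian hk x
  have hspec : normalizedKernelMatrix k x = spectralMatrix hA.eigenvectorBasis hA.eigenvalues :=
    eq_spectralMatrix _ fun i => hA.mulVec_eigenvectorBasis i
  have hdiag : ∀ a, 0 < normalizedKernelMatrix k x a a := by
    intro a
    rw [hspec, spectralMatrix, Matrix.of_apply]
    have h1 := orthonormalBasis_sum_mul hA.eigenvectorBasis a a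
    rw [if_pos rfl] at h1
    obtain ⟨i, -, hi⟩ : ∃ i ∈ Finset.univ,
        hA.eigenvectorBasis i a * hA.eigenvectorBasis i a ≠ 0 :=
      Finset.exists_ne_zero_of_sum_ne_zero (by rw [h1]; exact one_ne_zero)
    exact Finset.sum_pos' (fun j _ => mul_nonneg (hpos j).le (mul_self_nonneg _))
      ⟨i, Finset.mem_univ i, mul_pos (hpos i) (lt_of_le_of_ne (mul_self_nonneg _) hi.symm)⟩
  have hn0 : (n : ℝ) ≠ 0 := by positivity
  have hentry : ∀ a, normalizedKernelMatrix k x a a = 1 / n := by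
    intro a
    have h1 := hdiag a
    simp only [normalizedKernelMatrix, Matrix.of_apply, Real.sqrt_mul_self (hk.1 _ _)] at h1 ⊢
    have h2 : k (x a) (x a) ≠ 0 := by
      intro h0
      simp [h0] at h1
    rw [div_self h2, mul_one]
  have htr : (normalizedKernelMatrix k x).trace = 1 := by
    simp only [Matrix.trace, Matrix.diag, hentry]
    simp [hn0]
  rw [hspec, trace_spectralMatrix] at htr
  exact htr

end

/-- The widened interval has condition number at least `4`, which keeps `log κ` away from zero. -/
theorem four_mul_le_widenedUpper {u v : ℝ} (hu0 : 0 < u) (hu : u ≤ 1 / 2) :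
    4 * u ≤ widenedUpper u v := by
  refine le_trans ?_ (le_max_right _ _)
  have h : 3 / 2 * u ≤ √(2 * u - u ^ 2) := Real.le_sqrt_of_sq_le (by nlinarith)
  linarith

/-- The number of samples makes the failure probability of Hutch++ at most `δ`. -/
theorem exists_sample_bound {δ₁ D : ℝ} (h0 : 0 < δ₁) (h1 : δ₁ < 1) (hD : 1 ≤ D) :
    ∃ Cs : ℝ, 0 < Cs ∧ ∀ {e δ s : ℝ}, 0 < e → 0 < δ → δ ≤ δ₁ →
      Cs * (1 / e * √(Real.log (1 / δ)) + Real.log (1 / δ)) ≤ s →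
      8 ≤ s ∧ 3 * Real.exp (-(s / 4)) + 2 * Real.exp (-((min 1 e / D) ^ 2 * s ^ 2 / 128)) ≤ δ := by
  set L₀ := Real.log (1 / δ₁) with hL₀
  have hL₀pos : 0 < L₀ := Real.log_pos (by rw [lt_div_iff₀ h0]; linarith)
  -- With `L = log (1 / δ) ≥ L₀`, the factor `a` absorbs an additive constant, `L + 2 ≤ a L`, and
  -- the factor `c` gives `1 ≤ c L`.
  set a := 1 + 2 / L₀ with ha
  have ha1 : 1 ≤ a := by
    have : 0 < 2 / L₀ := by positivity
    linarith
  set c := 1 + 1 / L₀ with hc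
  have hc1 : 1 ≤ c := by
    have : 0 < 1 / L₀ := by positivity
    linarith
  have hcL : 1 ≤ c * L₀ := by
    rw [hc, add_mul, one_mul, one_div_mul_cancel hL₀pos.ne']
    linarith
  refine ⟨128 * a * D * c, by positivity, ?_⟩
  intro e δ s he hδ0 hδ hs
  set L := Real.log (1 / δ) with hL
  have hLL : L₀ ≤ L := Real.log_le_log (by positivity) (one_div_le_one_div_of_le hδ0 hδ)
  have hL0 : 0 < L := by linarith
  have haL : L + 2 ≤ a * L := by
    have : 2 ≤ 2 / L₀ * L := by
      rw [div_mul_eq_mul_div, le_div_iff₀ hL₀pos]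
      linarith
    rw [ha, add_mul]
    linarith
  have haD : 1 ≤ a * D := by nlinarith
  have hsL : 128 * (a * D) * c * L ≤ s := by
    have h2 : 0 ≤ 1 / e * √L := by positivity
    have h3 : 0 ≤ 128 * a * D * c * (1 / e * √L) := by positivity
    linarith
  have hse : 128 * (a * D) * c * √L ≤ s * e := by
    have h2 : 128 * (a * D) * c * (1 / e * √L) ≤ s := by
      have : 0 ≤ 128 * a * D * c * L := by positivity
      linarith
    calc 128 * (a * D) * c * √L = 128 * (a * D) * c * (1 / e * √L) * e := by field_simp
      _ ≤ s * e := by gcongr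
  have hcL1 : 1 ≤ c * L := hcL.trans (by gcongr)
  have hs128 : 128 ≤ s := by
    refine le_trans ?_ hsL
    have : 1 ≤ a * D * (c * L) := by nlinarith
    linarith
  have hs0 : 0 < s := by linarith
  have hkey : 128 * (a * D) * √L ≤ min 1 e * s := by
    rcases le_total 1 e with h | h
    · rw [min_eq_left h, one_mul]
      refine le_trans ?_ hsL
      have h2 : √L ≤ c * L := by
        have h3 := Real.sq_sqrt hL0.le
        rcases le_total 1 (√L) with h4 | h4
        · nlinarith
        · linarith
      calc 128 * (a * D) * √L ≤ 128 * (a * D) * (c * L) := by gcongr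
        _ = _ := by ring
    · rw [min_eq_right h, mul_comm e s]
      refine le_trans ?_ hse
      have : 0 ≤ 128 * (a * D) * √L := by positivity
      nlinarith
  have hsmall : ∀ y, L + 2 ≤ y → Real.exp (-y) ≤ δ / 6 := by
    intro y hy
    have h2 : Real.exp (-L) = δ := by
      rw [hL, one_div, Real.log_inv, neg_neg, Real.exp_log hδ0]
    have h3 : 6 ≤ Real.exp 2 := by
      have h4 := Real.exp_one_gt_d9
      have : Real.exp 2 = Real.exp 1 * Real.exp 1 := by rw [← Real.exp_add]; norm_num
      nlinarith
    calc Real.exp (-y) ≤ Real.exp (-L + -2) := Real.exp_le_exp.mpr (by linarith)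
      _ = δ * (Real.exp 2)⁻¹ := by rw [Real.exp_add, h2, Real.exp_neg]
      _ ≤ δ * 6⁻¹ := by gcongr
      _ = δ / 6 := by ring
  refine ⟨by linarith, ?_⟩
  have hexp1 : Real.exp (-(s / 4)) ≤ δ / 6 := by
    refine hsmall _ ?_
    have h2 : a * L ≤ a * D * c * L := by
      have : a * L * 1 ≤ a * L * (D * c) := by gcongr; nlinarith
      linarith
    linarith
  have hexp2 : Real.exp (-((min 1 e / D) ^ 2 * s ^ 2 / 128)) ≤ δ / 6 := by
    refine hsmall _ (haL.trans ?_)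
    have h2 : (128 * (a * D) * √L) ^ 2 ≤ (min 1 e * s) ^ 2 := by gcongr
    rw [mul_pow, Real.sq_sqrt hL0.le] at h2
    have h3 : (min 1 e / D) ^ 2 * s ^ 2 / 128 = (min 1 e * s) ^ 2 / (128 * D ^ 2) := by
      field_simp
    rw [h3, le_div_iff₀ (by positivity)]
    refine le_trans ?_ h2
    have h4 : a ≤ a ^ 2 := by nlinarith
    have h5 : a * (L * D ^ 2) ≤ a ^ 2 * (L * D ^ 2) := by gcongr
    have h6 : 0 ≤ a ^ 2 * (L * D ^ 2) := by positivity
    linarith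
  linarith

theorem sub_one_mul_le_sum_erase {n : ℕ} {g : Fin n → ℝ} {a : ℝ} {i₀ : Fin n} (hn : 0 < n)
    (hg : ∀ i, a ≤ g i) : ((n : ℝ) - 1) * a ≤ ∑ i ∈ Finset.univ.erase i₀, g i := by
  have h1 := Finset.card_nsmul_le_sum (Finset.univ.erase i₀) g a fun i _ => hg i
  rwa [Finset.card_erase_of_mem (Finset.mem_univ _), Finset.card_univ, Fintype.card_fin,
    nsmul_eq_mul, Nat.cast_sub (by omega), Nat.cast_one] at h1

/-- Both choices of the range finder admit a sketch with tail `128 T`, where `T` is the tail of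
`∑ i, w i ^ α` beyond its leading term: with `i₁` the last of the leading indices `I`, the scale is
`(w i₁ ^ α)⁻¹` for `B = F` and `w i₁ ^ (α - 2)` for `B = A`. -/
theorem exists_isSketchable {n k : ℕ} {α : ℝ} {w f : Fin n → ℝ} (hn : 2 ≤ n) (hk2 : 2 ≤ k)
    (hα0 : 0 < α) (hw0 : ∀ i, 0 < w i) (hflow : ∀ i, w i ^ α ≤ 2 * f i)
    (hfup : ∀ i, f i ≤ 2 * w i ^ α) :
    ∃ (I : Finset (Fin n)) (i₀ : Fin n), (∀ i, w i ≤ w i₀) ∧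
      (∃ β, IsSketchable k f f I β (128 * ∑ i ∈ Finset.univ.erase i₀, w i ^ α)) ∧
      (α ≤ 2 → ∃ β, IsSketchable k w f I β (128 * ∑ i ∈ Finset.univ.erase i₀, w i ^ α)) := by
  have hn0 : 0 < n := by omega
  have huw : ∀ i, 0 < w i ^ α := fun i => Real.rpow_pos_of_pos (hw0 i) α
  have hf0 : ∀ i, 0 < f i := fun i => by linarith [hflow i, huw i]
  obtain ⟨I, i₀, i₁, hI, hmax, hmin, htop, htsum, htoff⟩ :=
    exists_top_subset_tail hα0 hw0 hn0 (r := k / 2) (by omega)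
  set T := ∑ i ∈ Finset.univ.erase i₀, w i ^ α with hT
  have hT0 : 0 < T := by
    refine Finset.sum_pos (fun i _ => huw i) (Finset.card_pos.mp ?_)
    rw [Finset.card_erase_of_mem (Finset.mem_univ _), Finset.card_univ, Fintype.card_fin]
    omega
  have hpow_split : ∀ i, w i ^ α = w i ^ (α - 2) * w i ^ 2 := fun i => by
    rw [← Real.rpow_natCast (w i) 2, ← Real.rpow_add (hw0 i)]
    congr 1; push_cast; ring
  refine ⟨I, i₀, hmax, ⟨√(8 * (w i₁ ^ α)⁻¹ * k / (128 * T)), ?_⟩,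
    fun hα2 => ⟨√(8 * w i₁ ^ (α - 2) * k / (128 * T)), ?_⟩⟩
  · refine isSketchable_of_top_subset (c := (w i₁ ^ α)⁻¹) hk2 hw0 hT0
      (inv_nonneg.mpr (Real.rpow_nonneg (hw0 i₁).le α)) hI htsum htoff (fun i => (hf0 i).le) hfup
      (fun i hi => ?_) fun j hj => ?_
    · have h1 := Real.rpow_le_rpow (hw0 i₁).le (hmin i hi) hα0.le
      have h2 : 0 < w i₁ ^ α := Real.rpow_pos_of_pos (hw0 i₁) α
      have h3 := hflow i
      rw [← div_eq_inv_mul, mul_div_assoc', le_div_iff₀ h2]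
      nlinarith [hf0 i]
    · have h1 := Real.rpow_le_rpow (hw0 j).le (htop j hj) hα0.le
      have h2 : 0 < w i₁ ^ α := Real.rpow_pos_of_pos (hw0 i₁) α
      have h3 := hfup j
      rw [← div_eq_inv_mul, div_le_iff₀ h2]
      nlinarith [hf0 j, huw j]
  · refine isSketchable_of_top_subset (c := w i₁ ^ (α - 2)) hk2 hw0 hT0
      (Real.rpow_nonneg (hw0 i₁).le _) hI htsum htoff (fun i => (hf0 i).le) hfup
      (fun i hi => ?_) fun j hj => ?_
    · -- Here `α ≤ 2` enters: `t ^ (α - 2)` is decreasing.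
      have h1 := Real.rpow_le_rpow_of_nonpos (hw0 i₁) (hmin i hi) (by linarith : α - 2 ≤ 0)
      have h2 := mul_le_mul_of_nonneg_right h1 (sq_nonneg (w i))
      rw [← hpow_split] at h2
      linarith [huw i]
    · have h1 := Real.rpow_le_rpow_of_nonpos (hw0 j) (htop j hj) (by linarith : α - 2 ≤ 0)
      have h2 := mul_le_mul_of_nonneg_right h1 (sq_nonneg (w j))
      rw [← hpow_split] at h2
      linarith [huw j]

theorem one_sub_le_measureReal_of_compl_subset {Ω : Type*} [MeasurableSpace Ω] {μ : Measure Ω}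
    [IsProbabilityMeasure μ] {s t : Set Ω} {δ : ℝ} (hδ : 0 ≤ δ) (hst : sᶜ ⊆ t)
    (ht : μ t ≤ ENNReal.ofReal δ) : 1 - δ ≤ μ.real s := by
  have h1 : μ.real sᶜ ≤ δ := ENNReal.toReal_le_of_le_ofReal hδ ((measure_mono hst).trans ht)
  have h2 := measureReal_union_le (μ := μ) s sᶜ
  rw [Set.union_compl_self, probReal_univ] at h2
  linarith

theorem mainTheorem1 (δ₀ : ℝ) (hδ₀ : δ₀ < 1) :
    ∃ Cs : ℝ, 0 < Cs ∧ ∀ αmax : ℝ, ∃ Cm : ℝ, 0 < Cm ∧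
    ∀ (α ε δ : ℝ), 0 < α → α ≤ αmax → α ≠ 1 → 0 < ε → ε < 1 → 0 < δ → δ ≤ δ₀ →
    ∀ (X : Type*) (k : X → X → ℝ) (hk : IsInfinitelyDivisibleKernel k)
      (n : ℕ) (x : Fin n → X) (u v κ : ℝ), 2 ≤ n → 0 < u →
      (∀ i, (normalizedKernelMatrix_isHermitian hk x).eigenvalues i ∈ Set.Icc u v) →
      κ = widenedUpper u v / u →
    ∀ (s m : ℕ), 4 ∣ s →
      Cs * (1 / (ε * |α - 1|) * √(Real.log (1 / δ)) + Real.log (1 / δ)) ≤ (s : ℝ) →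
      Cm * (√κ * Real.log (κ / min 1 (ε * |α - 1|))) ≤ (m : ℝ) →
    ∀ B : Matrix (Fin n) (Fin n) ℝ,
      (B = chebyshevPower (normalizedKernelMatrix k x) α m u v ∨
        (B = normalizedKernelMatrix k x ∧ α ≤ 2)) →
      1 - δ ≤ ((gaussianMatrix n (s / 4)).prod (gaussianMatrix n (s / 2))).real
        {p | |chebyshevRenyi B (normalizedKernelMatrix k x) s α m u v
                (Matrix.of p.1) (Matrix.of p.2)
              - renyiEntropy α (normalizedKernelMatrix_isHermitian hk x)|
            ≤ ε * renyiEntropy α (normalizedKernelMatrix_isHermitian hk x)} := by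
  obtain ⟨C, hC1, hhutch⟩ := hutchpp_concentration
  -- Hutch++ may miss the trace by `τ T / 16`, where `T` is the tail and `τ = min 1 (ε |α - 1|)`;
  -- the tail for the sketch is `128 T`.
  obtain ⟨Cs, hCs, hsample⟩ := exists_sample_bound (δ₁ := max δ₀ (1 / 2)) (D := 2048 * C)
    (lt_max_of_lt_right (by norm_num)) (max_lt hδ₀ (by norm_num)) (by linarith)
  refine ⟨Cs, hCs, fun αmax => ?_⟩
  obtain ⟨Cm, hCm, hcheb⟩ := exists_abs_eval_chebyshevApprox_rpow_sub_le αmax (c := 1 / 32)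
    (by norm_num)
  refine ⟨Cm, hCm, ?_⟩
  intro α ε δ hα0 hαmax hα1 hε0 hε1 hδ0 hδ X k hk n x u v κ hn hu heig hκ s m hs4 hs hm B hB
  set A := normalizedKernelMatrix k x
  set hA := normalizedKernelMatrix_isHermitian hk x
  set w := hA.eigenvalues
  set U := hA.eigenvectorBasis
  have he : 0 < ε * |α - 1| := mul_pos hε0 (abs_pos.mpr (sub_ne_zero.mpr hα1))
  set τ := min 1 (ε * |α - 1|)
  have hτ0 : 0 < τ := lt_min one_pos he
  have hτ1 : τ ≤ 1 := min_le_left _ _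
  obtain ⟨hs8, hprob⟩ := hsample he hδ0 (hδ.trans (le_max_left _ _)) hs
  have hw0 : ∀ i, 0 < w i := fun i => hu.trans_le (heig i).1
  have hn0 : 0 < n := by omega
  have hn2 : (2 : ℝ) ≤ n := by exact_mod_cast hn
  have hsum : ∑ i, w i = 1 := sum_eigenvalues_normalizedKernelMatrix hk x hn0 hw0
  have hu2 : u ≤ 1 / 2 := by
    have h1 : (n : ℝ) * u ≤ 1 := by
      rw [← hsum]
      simpa using Finset.card_nsmul_le_sum Finset.univ w u fun i _ => (heig i).1
    nlinarith
  have hV : widenedUpper u v = κ * u := by rw [hκ]; field_simp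
  have hκ4 : 4 ≤ κ := by
    rw [hκ, le_div_iff₀ hu]; exact four_mul_le_widenedUpper hu hu2
  -- The spectral decompositions of `A` and of its approximate power.
  have hAspec : A = spectralMatrix U w := eq_spectralMatrix _ fun i => hA.mulVec_eigenvectorBasis i
  set f : Fin n → ℝ := fun i =>
    (chebyshevApprox (fun t => t ^ α) u (widenedUpper u v) m).eval (w i)
  have hFspec : chebyshevPower A α m u v = spectralMatrix U f :=
    eq_spectralMatrix _ fun i => aeval_mulVec_eq_smul (hA.mulVec_eigenvectorBasis i) _
  have hferr : ∀ i, |f i - w i ^ α| ≤ 1 / 32 * τ * u ^ α := fun i =>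
    hcheb hu hκ4 hV hα0 hαmax hτ0 hτ1 hm ⟨(heig i).1, (heig i).2.trans (le_max_left _ _)⟩
  have huα : 0 < u ^ α := Real.rpow_pos_of_pos hu α
  have huw : ∀ i, u ^ α ≤ w i ^ α := fun i => Real.rpow_le_rpow hu.le (heig i).1 hα0.le
  have hfclose : ∀ i, |f i - w i ^ α| ≤ 1 / 32 * w i ^ α := by
    intro i
    refine (hferr i).trans ?_
    have h1 := huw i
    nlinarith
  have hflow : ∀ i, w i ^ α ≤ 2 * f i := fun i => by
    have := (abs_le.mp (hfclose i)).1
    linarith [huw i]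
  have hfup : ∀ i, f i ≤ 2 * w i ^ α := fun i => by
    have := (abs_le.mp (hfclose i)).2
    linarith [huw i]
  -- The leading eigenvalues and the tail.
  have hs8' : 8 ≤ s := by exact_mod_cast hs8
  obtain ⟨I, i₀, hmax, ⟨βf, hskf⟩, hskw⟩ :=
    exists_isSketchable (k := s / 4) (by omega) (by omega) hα0 hw0 hflow hfup
  have hTu := sub_one_mul_le_sum_erase (i₀ := i₀) hn0 huw
  generalize hT : ∑ i ∈ Finset.univ.erase i₀, w i ^ α = T at *
  have hT0 : 0 < T := lt_of_lt_of_le (by nlinarith) hTu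
  have hsk : ∃ (b : Fin n → ℝ) (c : ℝ), B = spectralMatrix U b ∧
      IsSketchable (s / 4) b f I c (128 * T) := by
    rcases hB with hB | ⟨hB, hα2⟩
    · exact ⟨f, βf, hB.trans hFspec, hskf⟩
    · obtain ⟨βw, hβw⟩ := hskw hα2
      exact ⟨w, βw, hB.trans hAspec, hβw⟩
  obtain ⟨b, c, hBspec, hsk⟩ := hsk
  have hbad := hhutch U (t := τ / (2048 * C)) hs4 (by omega) (by positivity) hsk (by positivity)
    (by rw [div_le_one (by linarith)]; linarith)
  refine one_sub_le_measureReal_of_compl_subset hδ0.le (fun p hp => ?_)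
    (hbad.trans (ENNReal.ofReal_le_ofReal hprob))
  by_contra hcon
  refine hp ?_
  rw [Set.mem_ofPred_eq, not_lt] at hcon
  rw [show τ / (2048 * C) * (C * (128 * T)) = τ / 16 * T by field_simp; norm_num] at hcon
  have hF : |∑ i, f i - ∑ i, w i ^ α| ≤ τ / 16 * T := by
    rw [← Finset.sum_sub_distrib]
    refine (Finset.abs_sum_le_sum_abs _ _).trans ?_
    calc ∑ i, |f i - w i ^ α| ≤ ∑ _i : Fin n, 1 / 32 * τ * u ^ α :=
          Finset.sum_le_sum fun i _ => hferr i
      _ = τ / 32 * (n * u ^ α) := by simp; ring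
      _ ≤ τ / 32 * (2 * T) :=
          mul_le_mul_of_nonneg_left (by nlinarith) (by positivity)
      _ = _ := by ring
  have hfinal := abs_log_sub_log_sum_rpow_le hα0 hα1 hε0 hw0 hsum hmax
    ((abs_sub_le _ (∑ i, f i) _).trans ((add_le_add hcon hF).trans_eq
      (by rw [hT]; ring)))
  rw [← hBspec, ← hFspec] at hfinal
  exact hfinal
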